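/- Let $k$ be an algebraically closed field, $n$ a natural number, and let $\Lambda_n=kQ/J^2$ be the linear radical-square-zero Nakayama algebra of rank $n$, where $Q$ is the quiver $1\to 2\to\cdots\to n$, $kQ$ its path algebra and $J$ the arrow ideal; $\Lambda_n$-modules are identified with representations of $Q$ in which the composite of any two consecutive arrows is zero. A finitely generated indecomposable module $M$ is exceptional if $\operatorname{Hom}(M,M)\cong k$ and $\operatorname{Ext}^i(M,M)=0$ for all $i\ge 1$. A pair $(M,N)$ of exceptional modules is an exceptional pair if $\operatorname{Hom}(N,M)=0$ and $\operatorname{Ext}^i(N,M)=0$ for all $i\ge 1$. A complete exceptional sequence of $\Lambda_n$ is a sequence $E=(E_1,\ldots,E_n)$ of isomorphism classes of exceptional $\Lambda_n$-modules such that $(E_i,E_j)$ is an exceptional pair for all $i<j$. For a module $X$ let $P(X)$ and $I(X)$ be its projective cover and injective envelope, and let $\Omega^t(X)$ and $\Sigma^t(X)$ be its $t$-th syzygy in the minimal projective, respectively minimal injective, resolution ($\Omega^0(X)=\Sigma^0(X)=X$). For a simple module $S$, its projective chains are the sequences $(P(\Omega^t(S)),\ldots,P(\Omega(S)),P(S),S)$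 with $0\le t\le \operatorname{pdim}S-1$, and its injective chains are the sequences $(S,I(S),I(\Sigma(S)),\ldots,I(\Sigma^t(S)))$ with $0\le t\le\operatorname{indim}S-1$. We say that $E$ contains the chain from $S$ to $M$ if $S$ is a term of $E$ and, for some such $t$, one has $M\cong P(\Omega^t(S))$ and all terms of the corresponding projective chain occur in $E$, or $M\cong I(\Sigma^t(S))$ and all terms of the corresponding injective chain occur in $E$. Then for every complete exceptional sequence $E$ of $\Lambda_n$ and every $i$ such that $E_i$ is not simple there is exactly one position $j$ such that $E_j$ is simple and $E$ contains the chain from $E_j$ to $E_i$. Define $\Phi(E):\{1,\ldots,n\}\to\{1,\ldots,n\}$ by $\Phi(E)(i)=i$ if $E_i$ is simple, and $\Phi(E)(i)=j$, with this $j$, if $E_i$ is not simple. Then $\Phi(E)$ is idempotent, i.e. $\Phi(E)\circ\Phi(E)=\Phi(E)$, and $E\mapsto\Phi(E)$ is a bijection from the set of complete exceptional sequences of $\Lambda_n$ onto the set of idempotent functions $\{1,\ldots,n\}\to\{1,\ldots,n\}$. -/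

import Mathlib

open CategoryTheory CategoryTheory.Limits CategoryTheory.Abelian

universe u

/-! ### Radical square zero quiver algebras -/

/-- The radical square zero algebra `kQ / J²` of a finite quiver `Q` with set of vertices `V`, set
of arrows `A`, source map `s` and target map `t`, where `J` is the arrow ideal of the path algebra.
It has as `k`-basis the paths of length at most one: an element is a pair consisting of the
coefficients at the trivial paths `e_v` and the coefficients at the arrows. -/
@[ext]
structure RadSqZeroAlg (k : Type u) {V A : Type} (s t : A → V) : Type u where
  vert : V → k
  arr : A → k

namespace RadSqZeroAlg

variable {k : Type u} [Field k] {V A : Type} {s t : A → V}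

instance : Zero (RadSqZeroAlg k s t) := ⟨⟨0, 0⟩⟩
instance : Add (RadSqZeroAlg k s t) := ⟨fun x y => ⟨x.vert + y.vert, x.arr + y.arr⟩⟩
instance : Neg (RadSqZeroAlg k s t) := ⟨fun x => ⟨-x.vert, -x.arr⟩⟩
instance : SMul k (RadSqZeroAlg k s t) := ⟨fun c x => ⟨c • x.vert, c • x.arr⟩⟩

/-- The unit is the sum of all trivial paths. -/
instance : One (RadSqZeroAlg k s t) := ⟨⟨1, 0⟩⟩

/-- Multiplication is the bilinear extension of composition of paths (`p * q` means first `q`, then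
`p`), where paths of length two are zero: `e_v * e_v = e_v`, `e_(t a) * a = a`, `a * e_(s a) = a`,
and all other products of basis elements vanish. Left modules are therefore representations of the
quiver, an arrow `a` acting as a map from the space at `s a` to the space at `t a`. -/
instance : Mul (RadSqZeroAlg k s t) :=
  ⟨fun x y => ⟨fun v => x.vert v * y.vert v,
    fun a => x.vert (t a) * y.arr a + x.arr a * y.vert (s a)⟩⟩

@[simp] theorem zero_vert : (0 : RadSqZeroAlg k s t).vert = 0 := rfl
@[simp] theorem zero_arr : (0 : RadSqZeroAlg k s t).arr = 0 := rfl
@[simp] theorem one_vert : (1 : RadSqZeroAlg k s t).vert = 1 := rfl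
@[simp] theorem one_arr : (1 : RadSqZeroAlg k s t).arr = 0 := rfl
@[simp] theorem add_vert (x y : RadSqZeroAlg k s t) : (x + y).vert = x.vert + y.vert := rfl
@[simp] theorem add_arr (x y : RadSqZeroAlg k s t) : (x + y).arr = x.arr + y.arr := rfl
@[simp] theorem neg_vert (x : RadSqZeroAlg k s t) : (-x).vert = -x.vert := rfl
@[simp] theorem neg_arr (x : RadSqZeroAlg k s t) : (-x).arr = -x.arr := rfl
@[simp] theorem smul_vert (c : k) (x : RadSqZeroAlg k s t) : (c • x).vert = c • x.vert := rfl
@[simp] theorem smul_arr (c : k) (x : RadSqZeroAlg k s t) : (c • x).arr = c • x.arr := rfl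
@[simp] theorem mul_vert (x y : RadSqZeroAlg k s t) (v : V) :
    (x * y).vert v = x.vert v * y.vert v := rfl
@[simp] theorem mul_arr (x y : RadSqZeroAlg k s t) (a : A) :
    (x * y).arr a = x.vert (t a) * y.arr a + x.arr a * y.vert (s a) := rfl

instance : Ring (RadSqZeroAlg k s t) where
  add_assoc x y z := by ext <;> simp [add_assoc]
  zero_add x := by ext <;> simp
  add_zero x := by ext <;> simp
  add_comm x y := by ext <;> simp [add_comm]
  neg_add_cancel x := by ext <;> simp
  nsmul := nsmulRec
  zsmul := zsmulRec
  mul_assoc x y z := by ext <;> simp <;> ring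
  one_mul x := by ext <;> simp
  mul_one x := by ext <;> simp
  left_distrib x y z := by ext <;> simp <;> ring
  right_distrib x y z := by ext <;> simp <;> ring
  zero_mul x := by ext <;> simp
  mul_zero x := by ext <;> simp

instance : Module k (RadSqZeroAlg k s t) where
  one_smul x := by ext <;> simp
  mul_smul c d x := by ext <;> simp [mul_assoc]
  smul_zero c := by ext <;> simp
  smul_add c x y := by ext <;> simp [mul_add]
  add_smul c d x := by ext <;> simp [add_mul]
  zero_smul x := by ext <;> simp

instance : Algebra k (RadSqZeroAlg k s t) :=
  Algebra.ofModule
    (fun c x y => by ext <;> simp <;> ring)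
    (fun c x y => by ext <;> simp <;> ring)

end RadSqZeroAlg

/-- The linear radical square zero Nakayama algebra `Λ_n` of rank `n` over `k`: the radical square
zero algebra of the linearly oriented quiver `• → • → ⋯ → •` with `n` vertices, here numbered
`0, …, n - 1`, with one arrow `a → a + 1` for every `a < n - 1`. -/
abbrev LinearNakayama (k : Type u) (n : ℕ) : Type u :=
  RadSqZeroAlg k (V := Fin n) (A := Fin (n - 1))
    (fun a => ⟨a.val, by omega⟩) (fun a => ⟨a.val + 1, by omega⟩)

/-! ### Projective covers, injective envelopes, syzygies -/

section Resolutions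

variable {R : Type u} [Ring R]

/-- `p : P ⟶ M` is a projective cover: an essential epimorphism from a projective module. -/
structure IsProjectiveCover {P M : ModuleCat.{u} R} (p : P ⟶ M) : Prop where
  projective : Projective P
  epi : Epi p
  essential : ∀ (X : ModuleCat.{u} R) (g : X ⟶ P), Epi (g ≫ p) → Epi g

/-- `j : M ⟶ I` is an injective envelope: an essential monomorphism into an injective module. -/
structure IsInjectiveEnvelope {M I : ModuleCat.{u} R} (j : M ⟶ I) : Prop where
  injective : Injective I
  mono : Mono j
  essential : ∀ (Y : ModuleCat.{u} R) (g : I ⟶ Y), Mono (j ≫ g) → Mono g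

/-- `IsSyzygy M t N` : the module `N` is isomorphic to `Ω^t(M)`, the `t`-th syzygy in the minimal
projective resolution of `M`. -/
def IsSyzygy (M : ModuleCat.{u} R) : ℕ → ModuleCat.{u} R → Prop
  | 0, N => Nonempty (N ≅ M)
  | t + 1, N => ∃ (K P : ModuleCat.{u} R) (p : P ⟶ K),
      IsSyzygy M t K ∧ IsProjectiveCover p ∧ Nonempty (N ≅ kernel p)

/-- `IsCosyzygy M t N` : the module `N` is isomorphic to `Σ^t(M)`, the `t`-th syzygy in the minimal
injective resolution of `M`. -/
def IsCosyzygy (M : ModuleCat.{u} R) : ℕ → ModuleCat.{u} R → Prop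
  | 0, N => Nonempty (N ≅ M)
  | t + 1, N => ∃ (K I : ModuleCat.{u} R) (j : K ⟶ I),
      IsCosyzygy M t K ∧ IsInjectiveEnvelope j ∧ Nonempty (N ≅ cokernel j)

/-- `X` is isomorphic to `P(Ω^t(M))`. -/
def IsProjCoverOfSyzygy (M : ModuleCat.{u} R) (t : ℕ) (X : ModuleCat.{u} R) : Prop :=
  ∃ (K : ModuleCat.{u} R) (p : X ⟶ K), IsSyzygy M t K ∧ IsProjectiveCover p

/-- `X` is isomorphic to `I(Σ^t(M))`. -/
def IsInjEnvelopeOfCosyzygy (M : ModuleCat.{u} R) (t : ℕ) (X : ModuleCat.{u} R) : Prop :=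
  ∃ (K : ModuleCat.{u} R) (j : K ⟶ X), IsCosyzygy M t K ∧ IsInjectiveEnvelope j

end Resolutions

/-! ### Exceptional sequences -/

section Exceptional

/-- An exceptional module over a finite dimensional `k`-algebra `R`: a finitely generated
indecomposable module `M` with `Hom(M, M) ≅ k` and `Ext^i(M, M) = 0` for all `i ≥ 1`. -/
structure IsExceptional (k : Type u) [Field k] {R : Type u} [Ring R] [Algebra k R]
    (M : ModuleCat.{u} R) : Prop where
  finite : Module.Finite R M
  indecomposable : Indecomposable M
  hom : Nonempty ((M ⟶ M) ≃ₗ[k] k)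
  ext : ∀ i : ℕ, 1 ≤ i → Subsingleton (Ext M M i)

/-- The pair `(M, N)` of exceptional modules is an exceptional pair: `Hom(N, M) = 0` and
`Ext^i(N, M) = 0` for all `i ≥ 1`. -/
structure IsExceptionalPair (k : Type u) [Field k] {R : Type u} [Ring R] [Algebra k R]
    (M N : ModuleCat.{u} R) : Prop where
  left : IsExceptional k M
  right : IsExceptional k N
  hom : Subsingleton (N ⟶ M)
  ext : ∀ i : ℕ, 1 ≤ i → Subsingleton (Ext N M i)

/-- Isomorphism classes of `R`-modules. -/
abbrev ModIsoClass (R : Type u) [Ring R] : Type (u + 1) :=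
  Quotient (isIsomorphicSetoid (ModuleCat.{u} R))

/-- A module representing a given isomorphism class. -/
noncomputable abbrev ModIsoClass.rep {R : Type u} [Ring R] (c : ModIsoClass R) : ModuleCat.{u} R :=
  Quotient.out c

/-- An exceptional sequence of length `m`: a sequence of isomorphism classes of exceptional modules
such that `(E_i, E_j)` is an exceptional pair for all `i < j`. -/
structure IsExceptionalSequence (k : Type u) [Field k] {R : Type u} [Ring R] [Algebra k R] {m : ℕ}
    (E : Fin m → ModIsoClass R) : Prop where
  exceptional : ∀ i, IsExceptional k (E i).rep
  pair : ∀ i j, i < j → IsExceptionalPair k (E i).rep (E j).rep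

/-- The set of complete exceptional sequences of `Λ_n`, i.e. those of length `n`. -/
def CompleteExceptionalSequence (k : Type u) [Field k] (n : ℕ) : Type (u + 1) :=
  {E : Fin n → ModIsoClass (LinearNakayama k n) // IsExceptionalSequence k E}

/-- The term of a sequence `E` at position `x` is a simple module. -/
def SimpleAt {R : Type u} [Ring R] {m : ℕ} (E : Fin m → ModIsoClass R) (x : Fin m) : Prop :=
  IsSimpleModule R (E x).rep

/-- The sequence `E` contains the projective chain
`(P(Ω^t(S)), P(Ω^(t-1)(S)), …, P(S), S)`, `0 ≤ t ≤ pdim S - 1`, from the module `S` at position `y`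
to the module `P(Ω^t(S))` at position `x`. -/
def ContainsProjChain {R : Type u} [Ring R] {m : ℕ} (E : Fin m → ModIsoClass R)
    (y x : Fin m) : Prop :=
  ∃ t : ℕ, (t : WithBot ℕ∞) < projectiveDimension (E y).rep ∧
    IsProjCoverOfSyzygy (E y).rep t (E x).rep ∧
    ∀ r ≤ t, ∃ z : Fin m, IsProjCoverOfSyzygy (E y).rep r (E z).rep

/-- The sequence `E` contains the injective chain
`(S, I(S), I(Σ(S)), …, I(Σ^t(S)))`, `0 ≤ t ≤ indim S - 1`, from the module `S` at position `y`
to the module `I(Σ^t(S))` at position `x`. -/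
def ContainsInjChain {R : Type u} [Ring R] {m : ℕ} (E : Fin m → ModIsoClass R)
    (y x : Fin m) : Prop :=
  ∃ t : ℕ, (t : WithBot ℕ∞) < injectiveDimension (E y).rep ∧
    IsInjEnvelopeOfCosyzygy (E y).rep t (E x).rep ∧
    ∀ r ≤ t, ∃ z : Fin m, IsInjEnvelopeOfCosyzygy (E y).rep r (E z).rep

end Exceptional

/-!
Representations of the linear quiver with `n` vertices in which consecutive arrows compose to zero
have two kinds of indecomposables: the simple modules `S i` and, for every arrow `a : a → a + 1`,
the module `M a` with top `S a` and socle `S (a + 1)`. The modules `M a` are projective and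
injective, and the short exact sequences `0 ⟶ S (a + 1) ⟶ M a ⟶ S a ⟶ 0` splice to the minimal
projective and injective resolutions of the simple modules. Hence `Ω^t (S c) = S (c + t)`,
`Σ^t (S c) = S (c - t)`, `P(Ω^t (S c)) = M (c + t)`, `I(Σ^t (S c)) = M (c - t - 1)`, and
`Ext^m (S i, S j)` is nonzero exactly for `j = i + m`. A nonzero module with scalar endomorphisms is
one of the `S i` and `M a` (`RadSqZeroAlg.exists_iso_of_scalar_end`): if an arrow `a` acts
nontrivially, some nonzero endomorphism factors through `M a`, otherwise one factors through some
`S i`; as endomorphisms are scalar, this forces an isomorphism.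

Exceptional pairs thus become a combinatorial relation `Admissible` between vertices and arrows of
the quiver (`LinearNakayama.isExceptionalPair_iff`): vertices occur in increasing order, adjacent
arrows in decreasing order, a vertex `i` occurs after the arrow `i` and before the arrow `i - 1`.
Two vertices of a sequence are therefore never linked by arrows of the sequence
(`IsAdmissibleSeq.not_linked`). View the arrows of the sequence as edges on the `n` vertices of the
quiver; they cut it into intervals, each containing at most one vertex that is a term of the
sequence. As the sequence has `n` terms, each interval contains exactly one
(`IsAdmissibleSeq.exists_linkedTo`), its root, and `Φ` sends an arrow to the position of the root of
its interval.

Attach to an arrow its end farther from the root, and to a vertex the vertex itself. This numbers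
the positions by the nodes `0, …, n - 1`. The intervals follow one another in the order of the
positions of their roots, and inside an interval the order of positions is the reverse of the order
of nodes (`IsAdmissibleSeq.isNumbering_node`). So the numbering, and with it the sequence, can be
read off from the idempotent map `Φ(E)`, which gives injectivity
(`IsAdmissibleSeq.eq_of_isRootMap`); starting with any idempotent map, the same recipe `decode`
produces an admissible sequence (`isAdmissibleSeq_decode`, `isRootMap_decode`), which gives
surjectivity.
-/

/-! ### Simple modules and modules attached to arrows -/

namespace RadSqZeroAlg

open scoped ModuleCat

variable {k : Type u} [Field k] {V A : Type} {s t : A → V}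

/-- The space of the simple module at the vertex `v`. -/
def SimpleSpace (k : Type u) {V A : Type} (_s _t : A → V) (_v : V) : Type u := k

/-- The space of the uniserial module of length two attached to the arrow `a`: the first coordinate
lives at the source of `a`, the second one at its target. -/
def ArrowSpace (k : Type u) {V A : Type} (_s _t : A → V) (_a : A) : Type u := k × k

instance (v : V) : AddCommGroup (SimpleSpace k s t v) := inferInstanceAs (AddCommGroup k)

instance (a : A) : AddCommGroup (ArrowSpace k s t a) := inferInstanceAs (AddCommGroup (k × k))

instance (v : V) : SMul (RadSqZeroAlg k s t) (SimpleSpace k s t v) :=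
  ⟨fun r x => (r.vert v * (show k from x) : k)⟩

instance (a : A) : SMul (RadSqZeroAlg k s t) (ArrowSpace k s t a) :=
  ⟨fun r x => (r.vert (s a) * x.1, r.vert (t a) * x.2 + r.arr a * x.1)⟩

theorem ArrowSpace.smul_fst {a : A} (r : RadSqZeroAlg k s t) (x : ArrowSpace k s t a) :
    (r • x).1 = r.vert (s a) * x.1 := rfl

theorem ArrowSpace.smul_snd {a : A} (r : RadSqZeroAlg k s t) (x : ArrowSpace k s t a) :
    (r • x).2 = r.vert (t a) * x.2 + r.arr a * x.1 := rfl

@[ext]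
theorem ArrowSpace.ext {k : Type u} {a : A} {x y : ArrowSpace k s t a} (h₁ : x.1 = y.1)
    (h₂ : x.2 = y.2) : x = y := Prod.ext h₁ h₂

theorem ArrowSpace.add_fst {a : A} (x y : ArrowSpace k s t a) : (x + y).1 = x.1 + y.1 := rfl

theorem ArrowSpace.add_snd {a : A} (x y : ArrowSpace k s t a) : (x + y).2 = x.2 + y.2 := rfl

theorem ArrowSpace.zero_fst {a : A} : (0 : ArrowSpace k s t a).1 = 0 := rfl

theorem ArrowSpace.zero_snd {a : A} : (0 : ArrowSpace k s t a).2 = 0 := rfl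

instance (v : V) : Module (RadSqZeroAlg k s t) (SimpleSpace k s t v) where
  one_smul x := one_mul (show k from x)
  mul_smul r r' x := mul_assoc (r.vert v) (r'.vert v) (show k from x)
  smul_zero r := mul_zero (r.vert v)
  smul_add r x y := mul_add (r.vert v) (show k from x) (show k from y)
  add_smul r r' x := add_mul (r.vert v) (r'.vert v) (show k from x)
  zero_smul x := zero_mul (show k from x)

instance (a : A) : Module (RadSqZeroAlg k s t) (ArrowSpace k s t a) where
  one_smul x := by ext <;> simp [ArrowSpace.smul_fst, ArrowSpace.smul_snd]
  mul_smul r r' x := by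
    ext <;> simp [ArrowSpace.smul_fst, ArrowSpace.smul_snd] <;> ring
  smul_zero r := by
    ext <;> simp [ArrowSpace.smul_fst, ArrowSpace.smul_snd, ArrowSpace.zero_fst,
      ArrowSpace.zero_snd]
  smul_add r x y := by
    ext <;> simp [ArrowSpace.smul_fst, ArrowSpace.smul_snd, ArrowSpace.add_fst,
      ArrowSpace.add_snd] <;> ring
  add_smul r r' x := by
    ext <;> simp [ArrowSpace.smul_fst, ArrowSpace.smul_snd, ArrowSpace.add_fst,
      ArrowSpace.add_snd] <;> ring
  zero_smul x := by
    ext <;> simp [ArrowSpace.smul_fst, ArrowSpace.smul_snd, ArrowSpace.zero_fst,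
      ArrowSpace.zero_snd]

/-- The simple module at the vertex `v`. -/
abbrev simpleMod (k : Type u) [Field k] {V A : Type} (s t : A → V) (v : V) :
    ModuleCat.{u} (RadSqZeroAlg k s t) :=
  ModuleCat.of _ (SimpleSpace k s t v)

/-- The module of length two attached to the arrow `a`, with top the simple module at the source
of `a` and socle the simple module at its target. -/
abbrev arrowMod (k : Type u) [Field k] {V A : Type} (s t : A → V) (a : A) :
    ModuleCat.{u} (RadSqZeroAlg k s t) :=
  ModuleCat.of _ (ArrowSpace k s t a)

/-- The inclusion of the socle of `arrowMod k s t a`. -/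
def socleIncl (k : Type u) [Field k] {V A : Type} (s t : A → V) (a : A) :
    simpleMod k s t (t a) ⟶ arrowMod k s t a :=
  ModuleCat.ofHom
    { toFun := fun y => ((0, y) : k × k)
      map_add' := fun x y => by
        ext
        · exact (add_zero (0 : k)).symm
        · rfl
      map_smul' := fun r y => by
        ext
        · exact (mul_zero (r.vert (s a))).symm
        · change r.vert (t a) * (show k from y) = r.vert (t a) * (show k from y) + r.arr a * 0
          simp }

/-- The projection of `arrowMod k s t a` onto its top. -/
def topProj (k : Type u) [Field k] {V A : Type} (s t : A → V) (a : A) :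
    arrowMod k s t a ⟶ simpleMod k s t (s a) :=
  ModuleCat.ofHom
    { toFun := fun p => p.1
      map_add' := fun _ _ => rfl
      map_smul' := fun _ _ => rfl }

theorem socleIncl_topProj (a : A) : socleIncl k s t a ≫ topProj k s t a = 0 := rfl

instance (a : A) : Mono (socleIncl k s t a) := by
  rw [ModuleCat.mono_iff_injective]
  intro x y h
  exact congrArg Prod.snd h

instance (a : A) : Epi (topProj k s t a) := by
  rw [ModuleCat.epi_iff_surjective]
  intro x
  exact ⟨((x, 0) : k × k), rfl⟩

/-- The short exact sequence `0 ⟶ S (t a) ⟶ M a ⟶ S (s a) ⟶ 0`. -/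
abbrev arrowSeq (k : Type u) [Field k] {V A : Type} (s t : A → V) (a : A) :
    ShortComplex (ModuleCat.{u} (RadSqZeroAlg k s t)) :=
  ShortComplex.mk (socleIncl k s t a) (topProj k s t a) (socleIncl_topProj a)

theorem arrowSeq_shortExact (a : A) : (arrowSeq k s t a).ShortExact := by
  refine ShortComplex.ShortExact.mk' ?_ inferInstance inferInstance
  rw [ShortComplex.moduleCat_exact_iff]
  intro p hp
  exact ⟨p.2, Prod.ext (show p.1 = 0 from hp).symm rfl⟩

/-! ### Homomorphisms from and to arrow modules -/

section Homs

/-- The idempotent of the vertex `v`. -/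
def e [DecidableEq V] (v : V) : RadSqZeroAlg k s t := ⟨Pi.single v 1, 0⟩

/-- The element of the algebra given by the arrow `a`. -/
def α [DecidableEq A] (a : A) : RadSqZeroAlg k s t := ⟨0, Pi.single a 1⟩

theorem α_mul [DecidableEq A] (a : A) (r : RadSqZeroAlg k s t) :
    α a * r = r.vert (s a) • α a := by
  ext w
  · simp [α]
  · by_cases h : w = a
    · subst h; simp [α]
    · simp [α, h]

variable [DecidableEq V] [DecidableEq A]

/-- The element `x • e (s a) + y • α a` for `p = (x, y)`. It carries the vector `(1, 0)` of the
arrow module to `p`. -/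
def lift (a : A) (p : ArrowSpace k s t a) : RadSqZeroAlg k s t :=
  ⟨Pi.single (s a) p.1, Pi.single a p.2⟩

theorem e_target_mul_α (a : A) : (e (t a) : RadSqZeroAlg k s t) * α a = α a := by
  ext w
  · simp [e, α]
  · by_cases h : w = a
    · subst h; simp [e, α]
    · simp [e, α, h]

/-- As `t` is injective, `a` is the only arrow ending at `t a`. -/
theorem e_target_mul (ht : Function.Injective t) (a : A) (r : RadSqZeroAlg k s t) :
    e (t a) * r = r.vert (t a) • e (t a) + r.arr a • α a := by
  ext w
  · by_cases h : w = t a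
    · subst h; simp [e, α]
    · simp [e, α, h]
  · by_cases h : w = a
    · subst h; simp [e, α]
    · simp [e, α, h, ht.ne h]

/-- As `s` is injective, `a` is the only arrow starting at `s a`, so that `lift a` is linear. -/
theorem mul_lift (hs : Function.Injective s) (a : A) (r : RadSqZeroAlg k s t)
    (p : ArrowSpace k s t a) : r * lift a p = lift a (r • p) := by
  ext w
  · by_cases h : w = s a
    · subst h; simp [lift, ArrowSpace.smul_fst]
    · simp [lift, h]
  · by_cases h : w = a
    · subst h; simp [lift, ArrowSpace.smul_snd]
    · simp [lift, h, hs.ne h]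

theorem lift_add (a : A) (p q : ArrowSpace k s t a) : lift a (p + q) = lift a p + lift a q := by
  ext w
  · simp [lift, ArrowSpace.add_fst, Pi.single_add]
  · simp [lift, ArrowSpace.add_snd, Pi.single_add]

theorem lift_one_zero (a : A) : lift a ((1, 0) : k × k) = (e (s a) : RadSqZeroAlg k s t) := by
  ext w <;> simp [lift, e]

theorem lift_smul (a : A) (p : ArrowSpace k s t a) :
    lift a p • (show ArrowSpace k s t a from ((1, 0) : k × k)) = p := by
  ext
  · rw [ArrowSpace.smul_fst]; simp [lift]
  · rw [ArrowSpace.smul_snd]; simp [lift]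

omit [DecidableEq V] in
theorem α_smul_snd (a : A) (p : ArrowSpace k s t a) :
    ((α a : RadSqZeroAlg k s t) • p).2 = p.1 := by
  rw [ArrowSpace.smul_snd]; simp [α]

omit [DecidableEq A] in
theorem e_target_smul_snd (a : A) (p : ArrowSpace k s t a) :
    ((e (t a) : RadSqZeroAlg k s t) • p).2 = p.2 := by
  rw [ArrowSpace.smul_snd]; simp [e]

/-- As `s` is injective, `arrowMod k s t a` is the projective module generated by `e (s a)`; the
homomorphism to `W` sending the generator to `e (s a) • w`. -/
def fromArrow (hs : Function.Injective s) (a : A) {W : ModuleCat.{u} (RadSqZeroAlg k s t)}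
    (w : W) : arrowMod k s t a ⟶ W :=
  ModuleCat.ofHom
    { toFun := fun p => lift a p • w
      map_add' := fun p q => by rw [lift_add, add_smul]
      map_smul' := fun r p => by rw [← mul_lift hs, mul_smul]; rfl }

theorem fromArrow_apply (hs : Function.Injective s) (a : A)
    {W : ModuleCat.{u} (RadSqZeroAlg k s t)} (w : W) (p : ArrowSpace k s t a) :
    fromArrow hs a w p = lift a p • w := rfl

/-- As `t` is injective, `arrowMod k s t a` is the injective module dual to the right ideal
generated by `e (t a)`; the homomorphism from `W` given by a linear form on `W`. -/
def toArrow (ht : Function.Injective t) (a : A) {W : ModuleCat.{u} (RadSqZeroAlg k s t)}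
    (φ : W →ₗ[k] k) : W ⟶ arrowMod k s t a :=
  ModuleCat.ofHom
    { toFun := fun w => ((φ ((α a : RadSqZeroAlg k s t) • w),
        φ ((e (t a) : RadSqZeroAlg k s t) • w)) : k × k)
      map_add' := fun x y => by
        ext
        · rw [smul_add, map_add]; rfl
        · rw [smul_add, smul_add, map_add, map_add]; rfl
      map_smul' := fun r x => by
        ext
        · rw [← mul_smul, α_mul, smul_assoc, map_smul]; rfl
        · rw [← mul_smul, ← mul_smul, e_target_mul ht, add_smul, smul_assoc, smul_assoc, φ.map_add,
            φ.map_smul, φ.map_smul]; rfl }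

theorem toArrow_snd (ht : Function.Injective t) (a : A)
    {W : ModuleCat.{u} (RadSqZeroAlg k s t)} (φ : W →ₗ[k] k) (w : W) :
    (show k × k from toArrow ht a φ w).2 = φ ((e (t a) : RadSqZeroAlg k s t) • w) := rfl

end Homs

end RadSqZeroAlg

/-! ### Projectivity and injectivity of arrow modules -/

namespace RadSqZeroAlg

open scoped ModuleCat

variable {k : Type u} [Field k] {V A : Type} {s t : A → V}
variable [DecidableEq V] [DecidableEq A]

theorem arrowMod_projective (hs : Function.Injective s) (a : A) :
    Projective (arrowMod k s t a) where
  factors {E X} f p hp := by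
    obtain ⟨w, hw⟩ := (ModuleCat.epi_iff_surjective p).1 hp
      (f (show ArrowSpace k s t a from ((1, 0) : k × k)))
    refine ⟨fromArrow hs a w, ?_⟩
    -- The generator `(1, 0)` is sent to a preimage `w` of its image under `f`.
    refine ModuleCat.hom_ext (LinearMap.ext fun (q : ArrowSpace k s t a) => ?_)
    change p (lift a q • w) = f q
    rw [map_smul, hw, ← map_smul, lift_smul]

/-- The second coordinate of a homomorphism to an arrow module, as a linear form. -/
def sndForm {a : A} {W : ModuleCat.{u} (RadSqZeroAlg k s t)} (f : W ⟶ arrowMod k s t a) :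
    W →ₗ[k] k where
  toFun w := (show ArrowSpace k s t a from f w).2
  map_add' x y := by rw [map_add]; rfl
  map_smul' c x := by
    rw [← one_smul (RadSqZeroAlg k s t) x, ← smul_assoc, map_smul, one_smul]
    change c * 1 * _ + c * 0 * _ = c * _
    ring

/-- A homomorphism to an arrow module is determined by its second coordinate, because the arrow
carries the first coordinate to the second one. -/
theorem toArrow_sndForm (ht : Function.Injective t) {a : A}
    {W : ModuleCat.{u} (RadSqZeroAlg k s t)} (f : W ⟶ arrowMod k s t a) :
    toArrow ht a (sndForm f) = f := by
  refine ModuleCat.hom_ext (LinearMap.ext fun w => Prod.ext ?_ ?_)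
  · change (show ArrowSpace k s t a from f ((α a : RadSqZeroAlg k s t) • w)).2 = _
    rw [map_smul]
    exact α_smul_snd a _
  · change (show ArrowSpace k s t a from f ((e (t a) : RadSqZeroAlg k s t) • w)).2 = _
    rw [map_smul]
    exact e_target_smul_snd a _

/-- Homomorphisms to `arrowMod k s t a` amount to linear forms on the space at `t a`, and linear
forms extend from a submodule. -/
theorem arrowMod_injective (ht : Function.Injective t) (a : A) :
    Injective (arrowMod k s t a) where
  factors {X Y} f m hm := by
    have hinj := (ModuleCat.mono_iff_injective m).1 hm
    let mk : X →ₗ[k] Y := m.hom.restrictScalars k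
    obtain ⟨r, hr⟩ := LinearMap.exists_leftInverse_of_injective mk (LinearMap.ker_eq_bot.2 hinj)
    refine ⟨toArrow ht a ((sndForm f).comp r), ?_⟩
    have h : ∀ x : X, r (m x) = x := fun x => LinearMap.congr_fun hr x
    conv_rhs => rw [← toArrow_sndForm ht f]
    refine ModuleCat.hom_ext (LinearMap.ext fun x => Prod.ext ?_ ?_)
    · change sndForm f (r ((α a : RadSqZeroAlg k s t) • m x)) = _
      rw [← map_smul, h]; rfl
    · change sndForm f (r ((e (t a) : RadSqZeroAlg k s t) • m x)) = _
      rw [← map_smul, h]; rfl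

/-! ### Vanishing of homomorphisms -/

theorem subsingleton_arrowMod_hom_iff (hs : Function.Injective s) (a : A)
    (W : ModuleCat.{u} (RadSqZeroAlg k s t)) :
    Subsingleton (arrowMod k s t a ⟶ W) ↔
      ∀ w : W, (e (s a) : RadSqZeroAlg k s t) • w = 0 := by
  constructor
  · intro h w
    have h1 : fromArrow hs a w = 0 := Subsingleton.elim _ _
    have h2 : fromArrow hs a w (show ArrowSpace k s t a from ((1, 0) : k × k)) = 0 := by
      rw [h1]; rfl
    rwa [fromArrow_apply, lift_one_zero] at h2
  · refine fun h => ⟨fun f g => ?_⟩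
    have key : ∀ f : arrowMod k s t a ⟶ W, ∀ p : ArrowSpace k s t a, f p = 0 := by
      intro f p
      have h1 := lift_smul a (show ArrowSpace k s t a from ((1, 0) : k × k))
      rw [lift_one_zero] at h1
      rw [← lift_smul a p, map_smul, ← h1, map_smul, h, smul_zero]
    refine ModuleCat.hom_ext (LinearMap.ext fun (p : ArrowSpace k s t a) => ?_)
    exact (key f p).trans (key g p).symm

theorem subsingleton_hom_arrowMod_iff (ht : Function.Injective t) (a : A)
    (W : ModuleCat.{u} (RadSqZeroAlg k s t)) :
    Subsingleton (W ⟶ arrowMod k s t a) ↔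
      ∀ w : W, (e (t a) : RadSqZeroAlg k s t) • w = 0 := by
  constructor
  · intro h w
    refine (Module.forall_dual_apply_eq_zero_iff k _).1 fun φ => ?_
    rw [← toArrow_snd ht a φ w, Subsingleton.elim (toArrow ht a φ) 0]
    rfl
  · refine fun h => ⟨fun f g => ?_⟩
    have key : ∀ f : W ⟶ arrowMod k s t a, toArrow ht a (sndForm f) = 0 := by
      intro f
      refine ModuleCat.hom_ext (LinearMap.ext fun w => Prod.ext ?_ ?_)
      · change sndForm f ((α a : RadSqZeroAlg k s t) • w) = 0
        rw [← e_target_mul_α, mul_smul, h, map_zero]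
      · change sndForm f ((e (t a) : RadSqZeroAlg k s t) • w) = 0
        rw [h, map_zero]
    rw [← toArrow_sndForm ht f, ← toArrow_sndForm ht g, key, key]

omit [DecidableEq A] in
theorem e_smul_simpleMod_self (v : V) (x : simpleMod k s t v) :
    (e v : RadSqZeroAlg k s t) • x = x := by
  change (Pi.single v 1 : V → k) v * (show k from x) = _
  rw [Pi.single_eq_same, one_mul]

omit [DecidableEq A] in
theorem e_smul_simpleMod_eq_zero_iff (v w : V) :
    (∀ x : simpleMod k s t w, (e v : RadSqZeroAlg k s t) • x = 0) ↔ v ≠ w := by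
  constructor
  · rintro h rfl
    exact one_ne_zero (α := k) ((e_smul_simpleMod_self v (1 : k)).symm.trans (h (1 : k)))
  · intro h x
    change (Pi.single v 1 : V → k) w * (show k from x) = (0 : k)
    rw [Pi.single_eq_of_ne h.symm, zero_mul]

omit [DecidableEq A] in
theorem e_smul_arrowMod_eq_zero_iff (v : V) (a : A) :
    (∀ x : arrowMod k s t a, (e v : RadSqZeroAlg k s t) • x = 0) ↔ v ≠ s a ∧ v ≠ t a := by
  constructor
  · intro h
    constructor
    · rintro rfl
      have := congrArg Prod.fst (h ((1, 0) : k × k))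
      change (Pi.single (s a) 1 : V → k) (s a) * 1 = 0 at this
      simp at this
    · rintro rfl
      have := congrArg Prod.snd (h ((0, 1) : k × k))
      change (Pi.single (t a) 1 : V → k) (t a) * 1 + 0 * 0 = 0 at this
      simp at this
  · rintro ⟨h1, h2⟩ x
    refine Prod.ext ?_ ?_
    · change (Pi.single v 1 : V → k) (s a) * _ = 0
      simp [Ne.symm h1]
    · change (Pi.single v 1 : V → k) (t a) * _ + 0 * _ = 0
      simp [Ne.symm h2]

omit [DecidableEq A] in
theorem subsingleton_simpleMod_hom_iff (v w : V) :
    Subsingleton (simpleMod k s t v ⟶ simpleMod k s t w) ↔ v ≠ w := by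
  constructor
  · rintro h rfl
    have : (𝟙 (simpleMod k s t v)) (show k from 1) = 0 := by
      rw [Subsingleton.elim (𝟙 (simpleMod k s t v)) 0]; rfl
    exact one_ne_zero (α := k) this
  · intro h
    refine ⟨fun f g => ?_⟩
    ext x
    have key : ∀ f : simpleMod k s t v ⟶ simpleMod k s t w, f x = 0 := by
      intro f
      rw [← e_smul_simpleMod_self v x, map_smul]
      exact (e_smul_simpleMod_eq_zero_iff v w).2 h _
    exact (key f).trans (key g).symm

/-! ### Endomorphisms -/

section Brick

variable {R : Type u} [Ring R] [Algebra k R]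

/-- Two modules all of whose endomorphisms are scalar are isomorphic as soon as some nonzero
endomorphism of one of them factors through the other one. -/
theorem nonempty_iso_of_scalar_endomorphisms {X W : ModuleCat.{u} R}
    (hX : ∀ f : X ⟶ X, ∃ c : k, f = c • 𝟙 X) (hW : ∀ f : W ⟶ W, ∃ c : k, f = c • 𝟙 W)
    (f : X ⟶ W) (g : W ⟶ X) (h : g ≫ f ≠ 0) : Nonempty (W ≅ X) := by
  obtain ⟨c, hc⟩ := hW (g ≫ f)
  obtain ⟨d, hd⟩ := hX (f ≫ g)
  have hf : f ≠ 0 := by rintro rfl; simp at h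
  have hc0 : c ≠ 0 := by rintro rfl; simp [hc] at h
  -- Associativity of `f ≫ g ≫ f` shows that both composites are the same nonzero scalar.
  have hcd : c = d := by
    have h1 : f ≫ g ≫ f = c • f := by rw [hc]; simp
    have h2 : f ≫ g ≫ f = d • f := by rw [← Category.assoc, hd]; simp
    have h3 : (c - d) • f = 0 := by rw [sub_smul, ← h1, ← h2, sub_self]
    exact sub_eq_zero.1 ((smul_eq_zero.1 h3).resolve_right hf)
  refine ⟨⟨g, c⁻¹ • f, ?_, ?_⟩⟩
  · rw [Linear.comp_smul, hc, smul_smul, inv_mul_cancel₀ hc0, one_smul]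
  · rw [Linear.smul_comp, hd, ← hcd, smul_smul, inv_mul_cancel₀ hc0, one_smul]

theorem scalar_of_linearEquiv {X : ModuleCat.{u} R} (h0 : ¬ IsZero X)
    (h : Nonempty ((X ⟶ X) ≃ₗ[k] k)) (f : X ⟶ X) : ∃ c : k, f = c • 𝟙 X := by
  obtain ⟨φ⟩ := h
  have h1 : φ (𝟙 X) ≠ 0 := by
    intro h
    exact h0 ((IsZero.iff_id_eq_zero X).2 (φ.map_eq_zero_iff.1 h))
  refine ⟨φ f / φ (𝟙 X), φ.injective ?_⟩
  rw [map_smul, smul_eq_mul, div_mul_cancel₀ _ h1]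

theorem linearEquiv_of_scalar {X : ModuleCat.{u} R} (h0 : ¬ IsZero X)
    (h : ∀ f : X ⟶ X, ∃ c : k, f = c • 𝟙 X) : Nonempty ((X ⟶ X) ≃ₗ[k] k) := by
  have h1 : 𝟙 X ≠ 0 := fun h => h0 ((IsZero.iff_id_eq_zero X).2 h)
  refine ⟨(LinearEquiv.ofBijective (LinearMap.toSpanSingleton k (X ⟶ X) (𝟙 X)) ⟨?_, ?_⟩).symm⟩
  · rw [← LinearMap.ker_eq_bot]
    exact LinearMap.ker_toSpanSingleton k h1
  · intro f
    obtain ⟨c, hc⟩ := h f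
    exact ⟨c, by rw [hc, LinearMap.toSpanSingleton_apply]⟩

theorem indecomposable_of_scalar {X : ModuleCat.{u} R} (h0 : ¬ IsZero X)
    (h : ∀ f : X ⟶ X, ∃ c : k, f = c • 𝟙 X) : Indecomposable X := by
  refine ⟨h0, fun Y Z i => ?_⟩
  obtain ⟨c, hc⟩ := h (i.hom ≫ biprod.fst ≫ biprod.inl ≫ i.inv)
  have h1 : 𝟙 Y = c • 𝟙 Y := by
    have := congrArg (fun f => biprod.inl ≫ i.inv ≫ f ≫ i.hom ≫ biprod.fst) hc
    simpa using this
  have h2 : 0 = c • 𝟙 Z := by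
    have := congrArg (fun f => biprod.inr ≫ i.inv ≫ f ≫ i.hom ≫ biprod.snd) hc
    simpa using this
  rw [IsZero.iff_id_eq_zero, IsZero.iff_id_eq_zero]
  rcases smul_eq_zero.1 h2.symm with h3 | h3
  · left; rw [h1, h3, zero_smul]
  · right; exact h3

end Brick

end RadSqZeroAlg

/-! ### Simplicity and endomorphisms of the simple and arrow modules -/

namespace RadSqZeroAlg

open scoped ModuleCat

variable {k : Type u} [Field k] {V A : Type} {s t : A → V}

instance (v : V) : Nontrivial (SimpleSpace k s t v) := inferInstanceAs (Nontrivial k)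

instance (a : A) : Nontrivial (ArrowSpace k s t a) := inferInstanceAs (Nontrivial (k × k))

instance isSimpleModule_simpleMod (v : V) :
    IsSimpleModule (RadSqZeroAlg k s t) (SimpleSpace k s t v) := by
  classical
  rw [isSimpleModule_iff_toSpanSingleton_surjective]
  refine ⟨inferInstance, fun x hx y => ⟨⟨Pi.single v ((show k from y) / (show k from x)), 0⟩, ?_⟩⟩
  change (Pi.single v _ : V → k) v * (show k from x) = y
  rw [Pi.single_eq_same]
  exact div_mul_cancel₀ _ hx

theorem not_isSimpleModule_arrowMod (a : A) :
    ¬ IsSimpleModule (RadSqZeroAlg k s t) (ArrowSpace k s t a) := by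
  intro h
  rcases LinearMap.injective_or_eq_zero (topProj k s t a).hom with h1 | h1
  · have h2 : (show k × k from (0, 1)) = (0, 0) := h1 (a₁ := ((0, 1) : k × k))
      (a₂ := ((0, 0) : k × k)) rfl
    exact one_ne_zero (congrArg Prod.snd h2)
  · have h2 : (topProj k s t a).hom ((1, 0) : k × k) = 0 := by rw [h1]; rfl
    exact one_ne_zero (α := k) h2

theorem not_isZero_of_nontrivial {R : Type u} [Ring R] (M : ModuleCat.{u} R) [Nontrivial M] :
    ¬ IsZero M := by
  intro h
  obtain ⟨x, y, hxy⟩ := exists_pair_ne M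
  exact hxy ((ModuleCat.subsingleton_of_isZero h).elim x y)

theorem sum_vert {ι : Type} (S : Finset ι) (f : ι → RadSqZeroAlg k s t) :
    (∑ i ∈ S, f i).vert = ∑ i ∈ S, (f i).vert :=
  map_sum (⟨⟨vert, rfl⟩, add_vert⟩ : RadSqZeroAlg k s t →+ (V → k)) f S

theorem sum_arr {ι : Type} (S : Finset ι) (f : ι → RadSqZeroAlg k s t) :
    (∑ i ∈ S, f i).arr = ∑ i ∈ S, (f i).arr :=
  map_sum (⟨⟨arr, rfl⟩, add_arr⟩ : RadSqZeroAlg k s t →+ (A → k)) f S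

theorem smul_id_apply {W : ModuleCat.{u} (RadSqZeroAlg k s t)} (c : k) (w : W) :
    (c • 𝟙 W : W ⟶ W) w = (c • (1 : RadSqZeroAlg k s t)) • w := by
  rw [smul_assoc, one_smul]; rfl

theorem simpleMod_end (v : V) (f : simpleMod k s t v ⟶ simpleMod k s t v) :
    ∃ c : k, f = c • 𝟙 _ := by
  obtain ⟨d, hd⟩ : ∃ d : k, f (1 : k) = d := ⟨_, rfl⟩
  refine ⟨d, ModuleCat.hom_ext (LinearMap.ext fun x => ?_)⟩
  have h : (⟨fun _ => (show k from x), 0⟩ : RadSqZeroAlg k s t) •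
      (show simpleMod k s t v from (1 : k)) = x := mul_one (show k from x)
  refine Eq.trans ?_ (smul_id_apply d x).symm
  refine (congrArg f h).symm.trans ((map_smul f.hom _ _).trans ?_)
  change (show k from x) * (show k from f (1 : k)) = d * 1 * (show k from x)
  rw [hd, mul_one, mul_comm]

variable [DecidableEq V] [DecidableEq A]

/-- The image of the generator `(1, 0)` lies at the vertex `s a`, so it is a multiple of it. -/
theorem arrowMod_end {a : A} (ha : s a ≠ t a)
    (f : arrowMod k s t a ⟶ arrowMod k s t a) : ∃ c : k, f = c • 𝟙 _ := by
  have h1 := lift_one_zero (k := k) (s := s) (t := t) a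
  set u : ArrowSpace k s t a := ((1, 0) : k × k) with hu
  have h2 : (show k × k from f u).2 = 0 := by
    have h3 := lift_smul a u
    rw [h1] at h3
    have h4 : f u = (e (s a) : RadSqZeroAlg k s t) • f u := by
      rw [← map_smul]; exact congrArg f h3.symm
    rw [h4]
    change (Pi.single (s a) 1 : V → k) (t a) * _ + 0 * _ = _
    rw [Pi.single_eq_of_ne ha.symm, zero_mul, zero_mul, add_zero]
  refine ⟨(show k × k from f u).1, ModuleCat.hom_ext (LinearMap.ext fun x => ?_)⟩
  change f x = (_ • 𝟙 (arrowMod k s t a) : arrowMod k s t a ⟶ arrowMod k s t a) x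
  rw [smul_id_apply]
  have h5 : f x = lift a (show ArrowSpace k s t a from x) • f u := by
    rw [← map_smul]; exact congrArg f (lift_smul a x).symm
  rw [h5]
  refine Prod.ext ?_ ?_
  · change (Pi.single (s a) _ : V → k) (s a) * _ = _
    rw [Pi.single_eq_same]
    change _ = (show k × k from f u).1 * 1 * x.1
    rw [mul_one, mul_comm]
  · change (Pi.single (s a) _ : V → k) (t a) * _ + (Pi.single a _ : A → k) a * _ = _
    rw [Pi.single_eq_of_ne ha.symm, Pi.single_eq_same]
    change _ = (show k × k from f u).1 * 1 * x.2 + (show k × k from f u).1 * 0 * x.1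
    ring

/-! ### Classification of modules with scalar endomorphisms -/

section Classification

variable [Fintype V] [Fintype A]

omit [DecidableEq A] [Fintype A] in
theorem sum_e : ∑ v : V, (e v : RadSqZeroAlg k s t) = 1 := by
  ext w
  · simp [sum_vert, e, Finset.sum_apply, Pi.single_apply]
  · simp [sum_arr, e]

omit [DecidableEq V] [Fintype V] in
/-- An element of the algebra with vanishing vertex coefficients lies in the span of the arrows. -/
theorem eq_sum_α {r : RadSqZeroAlg k s t} (hr : r.vert = 0) : r = ∑ a : A, r.arr a • α a := by
  ext w
  · simp [sum_vert, α, hr]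
  · simp [sum_arr, α, Finset.sum_apply, Pi.single_apply]

omit [DecidableEq A] [Fintype A] in
theorem exists_e_smul_ne_zero {W : ModuleCat.{u} (RadSqZeroAlg k s t)} (h : ¬ IsZero W) :
    ∃ (v : V) (w : W), (e v : RadSqZeroAlg k s t) • w ≠ 0 := by
  by_contra! h1
  apply h
  have : Subsingleton W := by
    refine subsingleton_of_forall_eq 0 fun w => ?_
    rw [← one_smul (RadSqZeroAlg k s t) w, ← sum_e, Finset.sum_smul]
    exact Finset.sum_eq_zero fun v _ => h1 v w
  exact ModuleCat.isZero_of_subsingleton W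

omit [DecidableEq V] [Fintype V] in
/-- If all arrows act by zero, the action of the algebra only depends on the vertex coefficients. -/
theorem smul_eq_of_vert_eq {W : ModuleCat.{u} (RadSqZeroAlg k s t)}
    (h : ∀ (a : A) (w : W), (α a : RadSqZeroAlg k s t) • w = 0)
    {r r' : RadSqZeroAlg k s t} (hr : r.vert = r'.vert) (w : W) : r • w = r' • w := by
  have h1 : (r - r').vert = 0 := by
    rw [sub_eq_add_neg, add_vert, neg_vert, hr, add_neg_cancel]
  rw [← sub_eq_zero, ← sub_smul, eq_sum_α h1, Finset.sum_smul]
  exact Finset.sum_eq_zero fun a _ => by rw [smul_assoc, h, smul_zero]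

/-- Classification: a nonzero module with scalar endomorphisms is a simple module `simpleMod` or an
arrow module. If some arrow acts nontrivially, a nonzero endomorphism factors through its arrow
module; otherwise one factors through a simple module. -/
theorem exists_iso_of_scalar_end (hs : Function.Injective s) (ht : Function.Injective t)
    (hst : ∀ a, s a ≠ t a) {W : ModuleCat.{u} (RadSqZeroAlg k s t)} (h0 : ¬ IsZero W)
    (hW : ∀ f : W ⟶ W, ∃ c : k, f = c • 𝟙 W) :
    (∃ v, Nonempty (W ≅ simpleMod k s t v)) ∨ ∃ a, Nonempty (W ≅ arrowMod k s t a) := by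
  by_cases h : ∃ (a : A) (w : W), (α a : RadSqZeroAlg k s t) • w ≠ 0
  · obtain ⟨a, w, haw⟩ := h
    right
    refine ⟨a, ?_⟩
    obtain ⟨φ, hφ⟩ : ∃ φ : Module.Dual k W, φ ((α a : RadSqZeroAlg k s t) • w) ≠ 0 := by
      by_contra! h
      exact haw ((Module.forall_dual_apply_eq_zero_iff k _).1 h)
    refine nonempty_iso_of_scalar_endomorphisms (arrowMod_end (hst a)) hW
      (fromArrow hs a w) (toArrow ht a φ) fun h => ?_
    have h1 : fromArrow hs a w (toArrow ht a φ ((α a : RadSqZeroAlg k s t) • w)) = 0 := by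
      change (toArrow ht a φ ≫ fromArrow hs a w) _ = 0
      rw [h]; rfl
    -- The composite sends `α a • w` to `φ (α a • w) • α a • w`, since `α a * α a = 0`.
    rw [fromArrow_apply] at h1
    have h2 : lift a (toArrow ht a φ ((α a : RadSqZeroAlg k s t) • w)) =
        φ ((α a : RadSqZeroAlg k s t) • w) • (α a : RadSqZeroAlg k s t) := by
      have h3 : (α a * α a : RadSqZeroAlg k s t) = 0 := by rw [α_mul]; ext <;> simp [α]
      ext v
      · change (Pi.single (s a) (φ ((α a : RadSqZeroAlg k s t) • (α a : RadSqZeroAlg k s t) • w)) :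
          V → k) v = _
        rw [← mul_smul, h3, zero_smul, map_zero]
        simp [α]
      · change (Pi.single a (φ ((e (t a) : RadSqZeroAlg k s t) • (α a : RadSqZeroAlg k s t) • w)) :
          A → k) v = _
        rw [← mul_smul, e_target_mul_α]
        by_cases hv : v = a
        · subst hv; simp [α]
        · simp [α, hv]
    rw [h2, smul_assoc, smul_eq_zero] at h1
    exact h1.elim hφ haw
  · push Not at h
    obtain ⟨v, x, hvx⟩ := exists_e_smul_ne_zero h0
    left
    refine ⟨v, ?_⟩
    obtain ⟨φ, hφ⟩ : ∃ φ : Module.Dual k W, φ ((e v : RadSqZeroAlg k s t) • x) ≠ 0 := by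
      by_contra! h
      exact hvx ((Module.forall_dual_apply_eq_zero_iff k _).1 h)
    -- All arrows act by zero on `W`, so both maps below are linear over the algebra.
    let f : simpleMod k s t v ⟶ W := ModuleCat.ofHom
      { toFun := fun c => (⟨Pi.single v (show k from c), 0⟩ : RadSqZeroAlg k s t) • x
        map_add' := fun c d => by
          rw [← add_smul]
          exact smul_eq_of_vert_eq h (Pi.single_add v _ _) x
        map_smul' := fun r c => by
          rw [RingHom.id_apply, ← mul_smul]
          refine smul_eq_of_vert_eq h ?_ x
          ext w
          have key : ∀ c : k, (Pi.single v (r.vert v * c) : V → k) w =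
              r.vert w * (Pi.single v c : V → k) w := fun c => by
            by_cases hw : w = v
            · subst hw; simp
            · simp [hw]
          exact key c }
    let g : W ⟶ simpleMod k s t v := ModuleCat.ofHom
      { toFun := fun w => (φ ((e v : RadSqZeroAlg k s t) • w) : k)
        map_add' := fun c d => by rw [smul_add, map_add]; rfl
        map_smul' := fun r c => by
          rw [← mul_smul]
          have : (e v * r : RadSqZeroAlg k s t) • c =
              r.vert v • (e v : RadSqZeroAlg k s t) • c := by
            rw [← smul_assoc]
            refine smul_eq_of_vert_eq h ?_ c
            ext w
            by_cases hw : w = v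
            · subst hw; simp [e]
            · simp [e, hw]
          rw [this, φ.map_smul]; rfl }
    refine nonempty_iso_of_scalar_endomorphisms (simpleMod_end v) hW f g fun h1 => ?_
    have h2 : f (g x) = 0 := by
      change (g ≫ f) x = 0
      rw [h1]; rfl
    have h3 : f (g x) = φ ((e v : RadSqZeroAlg k s t) • x) • (e v : RadSqZeroAlg k s t) • x := by
      rw [← smul_assoc]
      refine smul_eq_of_vert_eq h ?_ x
      change (Pi.single v (φ ((e v : RadSqZeroAlg k s t) • x)) : V → k) = _
      ext w
      by_cases hw : w = v
      · subst hw; simp [e]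
      · simp [e, hw]
    rw [h3, smul_eq_zero] at h2
    exact h2.elim hφ hvx

end Classification

end RadSqZeroAlg

/-! ### Uniqueness of projective covers and injective envelopes -/

section Uniqueness

variable {R : Type u} [Ring R]

theorem IsProjectiveCover.exists_iso {P Q M : ModuleCat.{u} R} {p : P ⟶ M} {q : Q ⟶ M}
    (hp : IsProjectiveCover p) (hq : IsProjectiveCover q) : ∃ i : P ≅ Q, i.hom ≫ q = p := by
  have := hp.projective; have := hq.projective; have := hp.epi; have := hq.epi
  let f : P ⟶ Q := Projective.factorThru p q
  have hf : f ≫ q = p := Projective.factorThru_comp p q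
  have hfe : Epi f := hq.essential P f (hf ▸ hp.epi)
  let g : Q ⟶ P := Projective.factorThru (𝟙 Q) f
  have hg : g ≫ f = 𝟙 Q := Projective.factorThru_comp (𝟙 Q) f
  have hge : Epi g := hp.essential Q g (by
    rw [← hf, ← Category.assoc, hg, Category.id_comp]; exact hq.epi)
  refine ⟨⟨f, g, ?_, hg⟩, hf⟩
  rw [← cancel_epi g, ← Category.assoc, hg, Category.id_comp, Category.comp_id]

theorem IsInjectiveEnvelope.exists_iso {M I J : ModuleCat.{u} R} {i : M ⟶ I} {j : M ⟶ J}
    (hi : IsInjectiveEnvelope i) (hj : IsInjectiveEnvelope j) : ∃ f : I ≅ J, i ≫ f.hom = j := by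
  have := hi.injective; have := hj.injective; have := hi.mono; have := hj.mono
  let f : I ⟶ J := Injective.factorThru j i
  have hf : i ≫ f = j := Injective.comp_factorThru j i
  have hfm : Mono f := hi.essential J f (hf ▸ hj.mono)
  let g : J ⟶ I := Injective.factorThru (𝟙 I) f
  have hg : f ≫ g = 𝟙 I := Injective.comp_factorThru (𝟙 I) f
  have hgm : Mono g := hj.essential I g (by
    rw [← hf, Category.assoc, hg, Category.comp_id]; exact hi.mono)
  refine ⟨⟨f, g, hg, ?_⟩, hf⟩
  rw [← cancel_mono g, Category.assoc, hg, Category.id_comp, Category.comp_id]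

theorem IsProjectiveCover.of_iso {P P' M M' : ModuleCat.{u} R} {p : P ⟶ M}
    (hp : IsProjectiveCover p) (i : P' ≅ P) (j : M ≅ M') :
    IsProjectiveCover (i.hom ≫ p ≫ j.hom) where
  projective := Projective.of_iso i.symm hp.projective
  epi := by have := hp.epi; infer_instance
  essential X g hg := by
    have h1 : Epi ((g ≫ i.hom) ≫ p) := by
      have : (g ≫ i.hom) ≫ p = (g ≫ i.hom ≫ p ≫ j.hom) ≫ j.inv := by simp
      rw [this]; infer_instance
    have h2 := hp.essential X _ h1
    have : g = (g ≫ i.hom) ≫ i.inv := by simp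
    rw [this]; infer_instance

theorem IsInjectiveEnvelope.of_iso {M M' I I' : ModuleCat.{u} R} {i : M ⟶ I}
    (hi : IsInjectiveEnvelope i) (f : M' ≅ M) (g : I ≅ I') :
    IsInjectiveEnvelope (f.hom ≫ i ≫ g.hom) where
  injective := Injective.of_iso g hi.injective
  mono := by have := hi.mono; infer_instance
  essential Y h hh := by
    have h1 : Mono (i ≫ (g.hom ≫ h)) := by
      have : i ≫ g.hom ≫ h = f.inv ≫ ((f.hom ≫ i ≫ g.hom) ≫ h) := by simp
      rw [this]; infer_instance
    have h2 := hi.essential Y _ h1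
    have : h = g.inv ≫ (g.hom ≫ h) := by simp
    rw [this]; infer_instance

theorem IsSyzygy.of_iso {M M' N N' : ModuleCat.{u} R} {r : ℕ} (h : IsSyzygy M r N) (i : M ≅ M')
    (j : N ≅ N') : IsSyzygy M' r N' := by
  induction r generalizing N N' with
  | zero => exact h.map fun f => j.symm ≪≫ f ≪≫ i
  | succ r ih =>
    obtain ⟨K, P, p, hK, hp, ⟨f⟩⟩ := h
    exact ⟨K, P, p, ih hK (Iso.refl K), hp, ⟨j.symm ≪≫ f⟩⟩

theorem IsCosyzygy.of_iso {M M' N N' : ModuleCat.{u} R} {r : ℕ} (h : IsCosyzygy M r N)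
    (i : M ≅ M') (j : N ≅ N') : IsCosyzygy M' r N' := by
  induction r generalizing N N' with
  | zero => exact h.map fun f => j.symm ≪≫ f ≪≫ i
  | succ r ih =>
    obtain ⟨K, I, f, hK, hf, ⟨g⟩⟩ := h
    exact ⟨K, I, f, ih hK (Iso.refl K), hf, ⟨j.symm ≪≫ g⟩⟩

end Uniqueness

/-! ### Dimension shifting -/

section Shift

variable {C : Type*} [Category* C] [Abelian C] [HasExt C]

/-- If `Ext^m(X₂, Y) ⟶ Ext^m(X₁, Y)` vanishes and `Ext^(m + 1)(X₂, Y) = 0`, then the connecting map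
is an isomorphism. -/
theorem subsingleton_ext_succ_iff {S : ShortComplex C} (hS : S.ShortExact) (Y : C) (m : ℕ)
    (h₀ : ∀ x : Ext S.X₂ Y m, (Ext.mk₀ S.f).comp x (zero_add m) = 0)
    (h₁ : Subsingleton (Ext S.X₂ Y (m + 1))) :
    Subsingleton (Ext S.X₃ Y (m + 1)) ↔ Subsingleton (Ext S.X₁ Y m) := by
  constructor
  · intro h
    refine subsingleton_of_forall_eq 0 fun x => ?_
    obtain ⟨y, rfl⟩ := Ext.contravariant_sequence_exact₁ hS Y x (add_comm 1 m)
      (Subsingleton.elim _ _)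
    exact h₀ y
  · intro h
    refine subsingleton_of_forall_eq 0 fun x => ?_
    obtain ⟨y, rfl⟩ := Ext.contravariant_sequence_exact₃ hS Y x (Subsingleton.elim _ _)
      (add_comm 1 m)
    rw [Subsingleton.elim y 0, Ext.comp_zero]

end Shift

/-! ### Covers, envelopes and extensions of the simple modules -/

namespace RadSqZeroAlg

open scoped ModuleCat

variable {k : Type u} [Field k] {V A : Type} {s t : A → V}

variable [DecidableEq V] [DecidableEq A]

/-- A submodule of `arrowMod k s t a` mapping onto the top contains a vector with first coordinate
`1`, which generates the whole module. -/
theorem topProj_isProjectiveCover (hs : Function.Injective s) {a : A} (ha : s a ≠ t a) :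
    IsProjectiveCover (topProj k s t a) where
  projective := arrowMod_projective hs a
  epi := inferInstance
  essential X g hg := by
    rw [ModuleCat.epi_iff_surjective] at hg ⊢
    obtain ⟨x, hx⟩ := hg (1 : k)
    intro p
    refine ⟨lift a (show ArrowSpace k s t a from p) • x, ?_⟩
    rw [map_smul]
    have hx' : (show k × k from g x).1 = 1 := hx
    refine Prod.ext ?_ ?_
    · change (Pi.single (s a) (show k × k from p).1 : V → k) (s a) * (show k × k from g x).1 = _
      rw [hx', Pi.single_eq_same, mul_one]
    · change (Pi.single (s a) (show k × k from p).1 : V → k) (t a) * (show k × k from g x).2 +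
        (Pi.single a (show k × k from p).2 : A → k) a * (show k × k from g x).1 = _
      rw [hx', Pi.single_eq_same, Pi.single_eq_of_ne ha.symm, zero_mul, zero_add, mul_one]

/-- A nonzero submodule of `arrowMod k s t a` meets the socle: the arrow carries `(x, y)`
to `(0, x)`. -/
theorem socleIncl_isInjectiveEnvelope (ht : Function.Injective t) (a : A) :
    IsInjectiveEnvelope (socleIncl k s t a) where
  injective := arrowMod_injective ht a
  mono := inferInstance
  essential Y g hg := by
    rw [ModuleCat.mono_iff_injective] at hg ⊢
    rw [injective_iff_map_eq_zero] at hg ⊢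
    intro p hp
    have h1 : (show k × k from p).1 = 0 := by
      have h : g ((α a : RadSqZeroAlg k s t) • p) = 0 := by rw [map_smul, hp, smul_zero]
      have h2 : (α a : RadSqZeroAlg k s t) • p =
          socleIncl k s t a ((show k × k from p).1 : k) := by
        refine Prod.ext ?_ (α_smul_snd a p)
        change (0 : k) * _ = 0
        rw [zero_mul]
      rw [h2] at h
      exact hg _ h
    have h2 : p = socleIncl k s t a ((show k × k from p).2 : k) := Prod.ext h1 rfl
    rw [h2] at hp ⊢
    rw [hg _ hp, map_zero]

omit [DecidableEq A] in
/-- The simple module at a vertex without outgoing arrows is projective. -/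
theorem simpleMod_projective {v : V} (hv : ∀ a, s a ≠ v) : Projective (simpleMod k s t v) where
  factors {E X} f p hp := by
    obtain ⟨w, hw⟩ := (ModuleCat.epi_iff_surjective p).1 hp (f (1 : k))
    have key : ∀ (r : RadSqZeroAlg k s t) (c : k),
        (⟨Pi.single v (r.vert v * c), 0⟩ : RadSqZeroAlg k s t) = r * ⟨Pi.single v c, 0⟩ := by
      intro r c
      ext w
      · by_cases hw : w = v
        · subst hw; simp
        · simp [hw]
      · simp [hv w]
    refine ⟨ModuleCat.ofHom
      { toFun := fun c => (⟨Pi.single v (show k from c), 0⟩ : RadSqZeroAlg k s t) • w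
        map_add' := fun c d => by
          rw [← add_smul]
          congr 1
          ext a
          · exact congrFun (Pi.single_add (f := fun _ => k) v c d) a
          · simp
        map_smul' := fun r c => by
          rw [RingHom.id_apply, ← mul_smul]
          exact congrArg (· • w) (key r c) }, ?_⟩
    refine ModuleCat.hom_ext (LinearMap.ext fun c => ?_)
    change p ((⟨Pi.single v (show k from c), 0⟩ : RadSqZeroAlg k s t) • w) = f c
    rw [map_smul, hw]
    refine (map_smul f.hom _ _).symm.trans (congrArg f ?_)
    change (Pi.single v (show k from c) : V → k) v * 1 = c
    rw [Pi.single_eq_same, mul_one]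

omit [DecidableEq A] in
/-- The simple module at a vertex without incoming arrows is injective. -/
theorem simpleMod_injective {v : V} (hv : ∀ a, t a ≠ v) : Injective (simpleMod k s t v) where
  factors {X Y} f m hm := by
    have hinj := (ModuleCat.mono_iff_injective m).1 hm
    let mk : X →ₗ[k] Y := m.hom.restrictScalars k
    obtain ⟨q, hq⟩ := LinearMap.exists_leftInverse_of_injective mk (LinearMap.ker_eq_bot.2 hinj)
    have hq' : ∀ x : X, q (m x) = x := fun x => LinearMap.congr_fun hq x
    let φ : X →ₗ[k] k :=
      { toFun := fun x => (show k from f x)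
        map_add' := fun x y => map_add f.hom x y
        map_smul' := fun c x => by
          rw [← one_smul (RadSqZeroAlg k s t) x, ← smul_assoc]
          refine (map_smul f.hom _ _).trans ?_
          rw [one_smul]
          change c * 1 * _ = c * _
          rw [mul_one] }
    have key : ∀ r : RadSqZeroAlg k s t, e v * r = r.vert v • e v := by
      intro r
      ext w
      · by_cases hw : w = v
        · subst hw; simp [e]
        · simp [e, hw]
      · simp [e, hv w]
    refine ⟨ModuleCat.ofHom
      { toFun := fun y => (φ (q ((e v : RadSqZeroAlg k s t) • y)) : k)
        map_add' := fun x y => by rw [smul_add, map_add, map_add]; rfl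
        map_smul' := fun r y => by
          rw [← mul_smul, key, smul_assoc, q.map_smul, φ.map_smul]; rfl }, ?_⟩
    refine ModuleCat.hom_ext (LinearMap.ext fun x => ?_)
    change (show k from f (q ((e v : RadSqZeroAlg k s t) • m x))) = f x
    rw [← map_smul, hq']
    exact (map_smul f.hom _ _).trans (e_smul_simpleMod_self v _)

/-- `Ext^(m + 1)(S (s a), S v)` vanishes exactly when `Ext^m(S (t a), S v)` does: the arrow module
in between is projective, and its maps to simple modules kill the socle. -/
theorem subsingleton_ext_simpleMod_succ_iff (hs : Function.Injective s) (a : A) (v : V) (m : ℕ) :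
    Subsingleton (Ext (simpleMod k s t (s a)) (simpleMod k s t v) (m + 1)) ↔
      Subsingleton (Ext (simpleMod k s t (t a)) (simpleMod k s t v) m) := by
  have hP : Projective (arrowMod k s t a) := arrowMod_projective hs a
  refine subsingleton_ext_succ_iff (arrowSeq_shortExact (k := k) (s := s) (t := t) a) _ m ?_
    (HasProjectiveDimensionLT.subsingleton (arrowMod k s t a) 1 _ (by omega) _)
  intro x
  cases m with
  | succ m =>
    rw [(HasProjectiveDimensionLT.subsingleton (arrowMod k s t a) 1 (m + 1) (by omega) _).elim x 0,
      Ext.comp_zero]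
  | zero =>
    obtain ⟨f, rfl⟩ := Ext.homEquiv₀.symm.surjective x
    rw [Ext.homEquiv₀_symm_apply, Ext.mk₀_comp_mk₀]
    -- The socle is the image of the arrow, which acts by zero on a simple module.
    have : socleIncl k s t a ≫ f = 0 := by
      refine ModuleCat.hom_ext (LinearMap.ext fun y => ?_)
      have h2 : socleIncl k s t a y = (α a : RadSqZeroAlg k s t) •
          (show arrowMod k s t a from ((show k from y), (0 : k))) := by
        refine Prod.ext ?_ (α_smul_snd a (((show k from y), (0 : k)) : k × k)).symm
        change (0 : k) = 0 * _
        rw [zero_mul]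
      change f (socleIncl k s t a y) = 0
      rw [h2, map_smul]
      exact zero_mul (M₀ := k) _
    exact (congrArg Ext.mk₀ this).trans (Ext.mk₀_zero _ _)

end RadSqZeroAlg

/-! ### Invariance under isomorphism -/

section Invariance

theorem subsingleton_ext_congr {C : Type*} [Category* C] [Abelian C] [HasExt C] {X X' Y Y' : C}
    (e : X ≅ X') (f : Y ≅ Y') (m : ℕ) :
    Subsingleton (Ext X Y m) ↔ Subsingleton (Ext X' Y' m) := by
  have i : ((extFunctor m).obj (Opposite.op X)).obj Y ≅
      ((extFunctor m).obj (Opposite.op X')).obj Y' :=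
    ((extFunctor m).obj (Opposite.op X)).mapIso f ≪≫ ((extFunctor m).mapIso e.symm.op).app Y'
  exact i.addCommGroupIsoToAddEquiv.toEquiv.subsingleton_congr

theorem subsingleton_hom_congr {C : Type*} [Category* C] {X X' Y Y' : C}
    (e : X ≅ X') (f : Y ≅ Y') : Subsingleton (X ⟶ Y) ↔ Subsingleton (X' ⟶ Y') :=
  (e.homCongr f).subsingleton_congr

variable {k : Type u} [Field k] {R : Type u} [Ring R] [Algebra k R]

theorem IsExceptional.of_iso {M N : ModuleCat.{u} R} (h : IsExceptional k M) (e : M ≅ N) :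
    IsExceptional k N where
  finite := by have := h.finite; exact Module.Finite.equiv e.toLinearEquiv
  indecomposable :=
    ⟨fun h0 => h.indecomposable.1 (h0.of_iso e), fun Y Z i => h.indecomposable.2 Y Z (e ≪≫ i)⟩
  hom := h.hom.map fun φ => (Linear.homCongr k e e).symm.trans φ
  ext i hi := (subsingleton_ext_congr e e i).1 (h.ext i hi)

theorem simple_congr {M N : ModuleCat.{u} R} (e : M ≅ N) :
    IsSimpleModule R M ↔ IsSimpleModule R N :=
  ⟨fun _ => IsSimpleModule.congr e.symm.toLinearEquiv,
    fun _ => IsSimpleModule.congr e.toLinearEquiv⟩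

end Invariance

/-! ### Modules over the linear Nakayama algebra -/

namespace LinearNakayama

open RadSqZeroAlg

open scoped ModuleCat

/-- The source of the arrow `a`. -/
abbrev src (n : ℕ) (a : Fin (n - 1)) : Fin n := ⟨a.val, by omega⟩

/-- The target of the arrow `a`. -/
abbrev tgt (n : ℕ) (a : Fin (n - 1)) : Fin n := ⟨a.val + 1, by omega⟩

theorem src_injective (n : ℕ) : Function.Injective (src n) := fun a b h => by
  simpa [Fin.ext_iff] using h

theorem tgt_injective (n : ℕ) : Function.Injective (tgt n) := fun a b h => by
  simpa [Fin.ext_iff] using h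

theorem src_ne_tgt (n : ℕ) (a : Fin (n - 1)) : src n a ≠ tgt n a := by
  simp [Fin.ext_iff]

variable (k : Type u) [Field k] {n : ℕ}

/-- The simple module at the vertex `i`. -/
abbrev S (i : Fin n) : ModuleCat.{u} (LinearNakayama k n) := simpleMod k (src n) (tgt n) i

/-- The module of length two with top at the vertex `a` and socle at the vertex `a + 1`. -/
abbrev M (a : Fin (n - 1)) : ModuleCat.{u} (LinearNakayama k n) := arrowMod k (src n) (tgt n) a

variable {k}

/-- `Ext^m(S i, S j)` is nonzero exactly for `j = i + m`: shift `i` to `i + 1` and `m` to `m - 1`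
until a space of homomorphisms or a projective simple module is reached. -/
theorem subsingleton_ext_S_iff (i j : Fin n) (m : ℕ) :
    Subsingleton (Ext (S k i) (S k j) m) ↔ i.val + m ≠ j.val := by
  induction m generalizing i with
  | zero =>
    rw [Ext.homEquiv₀.subsingleton_congr, subsingleton_simpleMod_hom_iff, Ne, Fin.ext_iff, add_zero]
  | succ m ih =>
    by_cases h : i.val + 1 < n
    · have h1 := subsingleton_ext_simpleMod_succ_iff (k := k) (src_injective n) (t := tgt n)
        ⟨i.val, by omega⟩ j m
      refine h1.trans ((ih _).trans ?_)
      simp only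
      omega
    · have : Projective (S k i) := simpleMod_projective fun a ha => by
        have := congrArg Fin.val ha
        simp at this
        omega
      refine iff_of_true (HasProjectiveDimensionLT.subsingleton _ 1 _ (by omega) _) ?_
      omega

theorem hasProjectiveDimensionLT_S (c : Fin n) (r : ℕ) (h : n ≤ c.val + r + 1) :
    HasProjectiveDimensionLT (S k c) (r + 1) := by
  induction r generalizing c with
  | zero =>
    have : Projective (S k c) := simpleMod_projective fun a ha => by
      have := congrArg Fin.val ha
      simp at this
      omega
    infer_instance
  | succ r ih =>
    by_cases hc : c.val + 1 < n
    · exact ((arrowSeq_shortExact (k := k) (s := src n) (t := tgt n)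
        ⟨c.val, by omega⟩).hasProjectiveDimensionLT_X₃_iff r
          (arrowMod_projective (src_injective n) _)).2 (ih _ (by simp only; omega))
    · have := ih c (by omega)
      exact hasProjectiveDimensionLT_of_ge _ (r + 1) _ (by omega)

theorem hasInjectiveDimensionLT_S (c : Fin n) (r : ℕ) (h : c.val ≤ r) :
    HasInjectiveDimensionLT (S k c) (r + 1) := by
  induction r generalizing c with
  | zero =>
    have : Injective (S k c) := simpleMod_injective fun a ha => by
      have := congrArg Fin.val ha
      simp at this
      omega
    infer_instance
  | succ r ih =>
    by_cases hc : 0 < c.val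
    · have hc' : c = tgt n ⟨c.val - 1, by omega⟩ := by ext; simp only; omega
      have h1 := ((arrowSeq_shortExact (k := k) (s := src n) (t := tgt n)
        ⟨c.val - 1, by omega⟩).hasInjectiveDimensionLT_X₃_iff r
          (arrowMod_injective (tgt_injective n) _)).1 (ih _ (by simp only; omega))
      rw [hc']
      exact h1
    · have := ih c (by omega)
      exact hasInjectiveDimensionLT_of_ge _ (r + 1) _ (by omega)

/-- The projective dimension of `S c` is `n - 1 - c`. -/
theorem lt_projectiveDimension_S_iff (c : Fin n) (r : ℕ) :
    (r : WithBot ℕ∞) < projectiveDimension (S k c) ↔ c.val + r + 1 < n := by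
  rw [← not_le, projectiveDimension_le_iff, ← not_le, not_iff_not]
  refine ⟨fun h => ?_, hasProjectiveDimensionLT_S c r⟩
  by_contra! hlt
  exact (subsingleton_ext_S_iff (k := k) c ⟨c.val + (r + 1), by omega⟩ (r + 1)).1
    (HasProjectiveDimensionLT.subsingleton _ (r + 1) _ le_rfl _) rfl

/-- The injective dimension of `S c` is `c`. -/
theorem lt_injectiveDimension_S_iff (c : Fin n) (r : ℕ) :
    (r : WithBot ℕ∞) < injectiveDimension (S k c) ↔ r < c.val := by
  rw [← not_le, injectiveDimension_le_iff, ← not_le, not_iff_not]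
  refine ⟨fun h => ?_, hasInjectiveDimensionLT_S c r⟩
  by_contra! hlt
  exact (subsingleton_ext_S_iff (k := k) ⟨c.val - (r + 1), by omega⟩ c (r + 1)).1
    (HasInjectiveDimensionLT.subsingleton _ (r + 1) _ le_rfl _) (by simp only; omega)

/-! ### Syzygies, projective covers and injective envelopes -/

theorem isSyzygy_S_iff (c : Fin n) (r : ℕ) (h : c.val + r < n)
    (N : ModuleCat.{u} (LinearNakayama k n)) :
    IsSyzygy (S k c) r N ↔ Nonempty (N ≅ S k ⟨c.val + r, h⟩) := by
  induction r generalizing N with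
  | zero => rfl
  | succ r ih =>
    let a : Fin (n - 1) := ⟨c.val + r, by omega⟩
    have hcov : IsProjectiveCover (topProj k (src n) (tgt n) a) :=
      topProj_isProjectiveCover (src_injective n) (src_ne_tgt n a)
    have hker : S k ⟨c.val + (r + 1), h⟩ ≅ kernel (topProj k (src n) (tgt n) a) :=
      (arrowSeq_shortExact (k := k) (s := src n) (t := tgt n) a).fIsKernel.conePointUniqueUpToIso
        (limit.isLimit _)
    constructor
    · rintro ⟨K, P, p, hK, hp, ⟨i⟩⟩
      obtain ⟨j⟩ := (ih (by omega) K).1 hK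
      have hp' : IsProjectiveCover (p ≫ j.hom) := by
        simpa using hp.of_iso (Iso.refl P) j
      obtain ⟨f, hf⟩ := hp'.exists_iso hcov
      refine ⟨i ≪≫ (kernelCompMono p j.hom).symm ≪≫ kernel.mapIso _ _ f (Iso.refl _) ?_ ≪≫
        hker.symm⟩
      rw [hf]; simp
    · rintro ⟨i⟩
      exact ⟨_, _, _, (ih (by omega) _).2 ⟨Iso.refl _⟩, hcov, ⟨i ≪≫ hker⟩⟩

theorem isCosyzygy_S_iff (c : Fin n) (r : ℕ) (h : r ≤ c.val)
    (N : ModuleCat.{u} (LinearNakayama k n)) :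
    IsCosyzygy (S k c) r N ↔ Nonempty (N ≅ S k ⟨c.val - r, by omega⟩) := by
  induction r generalizing N with
  | zero => rfl
  | succ r ih =>
    let a : Fin (n - 1) := ⟨c.val - (r + 1), by omega⟩
    have hcov : IsInjectiveEnvelope (socleIncl k (src n) (tgt n) a) :=
      socleIncl_isInjectiveEnvelope (tgt_injective n) a
    have ha : (⟨c.val - r, by omega⟩ : Fin n) = tgt n a := by
      ext; simp only [a]; omega
    have hcok : S k ⟨c.val - (r + 1), by omega⟩ ≅ cokernel (socleIncl k (src n) (tgt n) a) :=
      (arrowSeq_shortExact (k := k) (s := src n) (t := tgt n)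
        a).gIsCokernel.coconePointUniqueUpToIso (colimit.isColimit _)
    replace ih := ih (by omega)
    rw [ha] at ih
    constructor
    · rintro ⟨K, I, p, hK, hp, ⟨i⟩⟩
      obtain ⟨j⟩ := (ih K).1 hK
      have hp' : IsInjectiveEnvelope (j.inv ≫ p) := by
        simpa using hp.of_iso j.symm (Iso.refl I)
      obtain ⟨f, hf⟩ := hp'.exists_iso hcov
      refine ⟨i ≪≫ (cokernelEpiComp j.inv p).symm ≪≫ cokernel.mapIso _ _ (Iso.refl _) f ?_ ≪≫
        hcok.symm⟩
      rw [hf]; simp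
    · rintro ⟨i⟩
      exact ⟨_, _, _, (ih _).2 ⟨Iso.refl _⟩, hcov, ⟨i ≪≫ hcok⟩⟩

theorem isProjCoverOfSyzygy_iff {c : Fin n} {T : ModuleCat.{u} (LinearNakayama k n)}
    (e : T ≅ S k c) (r : ℕ) (h : c.val + r < n - 1) (X : ModuleCat.{u} (LinearNakayama k n)) :
    IsProjCoverOfSyzygy T r X ↔ Nonempty (X ≅ M k ⟨c.val + r, h⟩) := by
  have hcov : IsProjectiveCover (topProj k (src n) (tgt n) ⟨c.val + r, h⟩) :=
    topProj_isProjectiveCover (src_injective n) (src_ne_tgt n _)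
  constructor
  · rintro ⟨K, p, hK, hp⟩
    obtain ⟨j⟩ := (isSyzygy_S_iff c r (by omega) K).1 (hK.of_iso e (Iso.refl K))
    obtain ⟨f, -⟩ := (hp.of_iso (Iso.refl X) j).exists_iso hcov
    exact ⟨f⟩
  · rintro ⟨i⟩
    have hS := (isSyzygy_S_iff (k := k) c r (by omega) _).2 ⟨Iso.refl _⟩
    exact ⟨_, _, hS.of_iso e.symm (Iso.refl _), hcov.of_iso i (Iso.refl _)⟩

theorem isInjEnvelopeOfCosyzygy_iff {c : Fin n} {T : ModuleCat.{u} (LinearNakayama k n)}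
    (e : T ≅ S k c) (r : ℕ) (h : r < c.val) (X : ModuleCat.{u} (LinearNakayama k n)) :
    IsInjEnvelopeOfCosyzygy T r X ↔ Nonempty (X ≅ M k ⟨c.val - (r + 1), by omega⟩) := by
  have hcov : IsInjectiveEnvelope (socleIncl k (src n) (tgt n) ⟨c.val - (r + 1), by omega⟩) :=
    socleIncl_isInjectiveEnvelope (tgt_injective n) _
  have ha : (⟨c.val - r, by omega⟩ : Fin n) = tgt n ⟨c.val - (r + 1), by omega⟩ := by
    ext; simp only; omega
  constructor
  · rintro ⟨K, p, hK, hp⟩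
    obtain ⟨j⟩ := (isCosyzygy_S_iff c r h.le K).1 (hK.of_iso e (Iso.refl K))
    rw [ha] at j
    obtain ⟨f, -⟩ := (hp.of_iso j.symm (Iso.refl X)).exists_iso hcov
    exact ⟨f⟩
  · rintro ⟨i⟩
    have hS := (isCosyzygy_S_iff (k := k) c r h.le _).2 ⟨Iso.refl _⟩
    rw [ha] at hS
    exact ⟨_, _, hS.of_iso e.symm (Iso.refl _), hcov.of_iso (Iso.refl _) i.symm⟩

end LinearNakayama

namespace LinearNakayama

open RadSqZeroAlg

open scoped ModuleCat

/-! ### Exceptional modules and exceptional pairs -/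

variable (k : Type u) [Field k] {n : ℕ}

/-- The indecomposable modules: `inl i` stands for the simple module at `i`, `inr a` for the module
of length two with top at `a` and socle at `a + 1`. -/
abbrev indec : Fin n ⊕ Fin (n - 1) → ModuleCat.{u} (LinearNakayama k n) :=
  Sum.elim (S k) (M k)

/-- The number of a vertex or an arrow, forgetting the bound. -/
abbrev code : Fin n ⊕ Fin (n - 1) → ℕ ⊕ ℕ := Sum.map Fin.val Fin.val

theorem code_injective : Function.Injective (code (n := n)) :=
  Sum.map_injective.2 ⟨Fin.val_injective, Fin.val_injective⟩

end LinearNakayama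

/-- The combinatorial form of exceptional pairs: `Admissible d d'` says that the module with code
`d'` has neither homomorphisms nor extensions to the one with code `d`. Here `inl i` is the simple
module at `i` and `inr a` is the module of length two with top at `a` and socle at `a + 1`. -/
def Admissible : ℕ ⊕ ℕ → ℕ ⊕ ℕ → Prop
  | .inl i, .inl j => i < j
  | .inl i, .inr a => i ≠ a
  | .inr a, .inl i => i ≠ a + 1
  | .inr a, .inr b => b ≠ a ∧ b ≠ a + 1

namespace LinearNakayama

open RadSqZeroAlg

open scoped ModuleCat

variable {k : Type u} [Field k] {n : ℕ}

theorem indec_not_isZero (d : Fin n ⊕ Fin (n - 1)) : ¬ IsZero (indec k d) := by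
  rcases d with i | a
  · exact not_isZero_of_nontrivial (S k i)
  · exact not_isZero_of_nontrivial (M k a)

theorem indec_end (d : Fin n ⊕ Fin (n - 1)) (f : indec k d ⟶ indec k d) :
    ∃ c : k, f = c • 𝟙 _ := by
  rcases d with i | a
  · exact simpleMod_end i f
  · exact arrowMod_end (src_ne_tgt n a) f

theorem indec_isExceptional (d : Fin n ⊕ Fin (n - 1)) : IsExceptional k (indec k d) where
  finite := by
    rcases d with i | a
    · exact inferInstanceAs (Module.Finite _ (SimpleSpace k (src n) (tgt n) i))
    · refine Module.Finite.of_surjective (LinearMap.toSpanSingleton (LinearNakayama k n) (M k a)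
        ((1, 0) : k × k)) fun p => ?_
      exact ⟨lift a (show ArrowSpace k (src n) (tgt n) a from p), lift_smul a p⟩
  indecomposable := indec_end d |> indecomposable_of_scalar (indec_not_isZero d)
  hom := linearEquiv_of_scalar (indec_not_isZero d) (indec_end d)
  ext m hm := by
    rcases d with i | a
    · exact (subsingleton_ext_S_iff i i m).2 (by omega)
    · have : Projective (M k a) := arrowMod_projective (src_injective n) a
      exact HasProjectiveDimensionLT.subsingleton (M k a) 1 m hm _

theorem exists_iso_indec {W : ModuleCat.{u} (LinearNakayama k n)} (h : IsExceptional k W) :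
    ∃ d, Nonempty (W ≅ indec k d) := by
  rcases exists_iso_of_scalar_end (src_injective n) (tgt_injective n) (src_ne_tgt n)
    h.indecomposable.1 (scalar_of_linearEquiv h.indecomposable.1 h.hom) with ⟨i, hi⟩ | ⟨a, ha⟩
  · exact ⟨.inl i, hi⟩
  · exact ⟨.inr a, ha⟩

theorem isSimpleModule_iff {W : ModuleCat.{u} (LinearNakayama k n)} {d : Fin n ⊕ Fin (n - 1)}
    (e : W ≅ indec k d) : IsSimpleModule (LinearNakayama k n) W ↔ d.isLeft := by
  rw [simple_congr e]
  rcases d with i | a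
  · exact iff_of_true (isSimpleModule_simpleMod i) rfl
  · exact iff_of_false (not_isSimpleModule_arrowMod a) (by simp)

/-- Extensions involving a module of length two vanish, because it is projective and injective; so
only homomorphisms matter, except between two simple modules. -/
theorem subsingleton_hom_indec_iff (d d' : Fin n ⊕ Fin (n - 1)) :
    (Subsingleton (indec k d' ⟶ indec k d) ∧
      ∀ m : ℕ, 1 ≤ m → Subsingleton (Ext (indec k d') (indec k d) m)) ↔
      Admissible (code d) (code d') := by
  rcases d' with i | a
  · rcases d with j | b
    · change _ ↔ j.val < i.val
      rw [← (Ext.homEquiv₀ (X := indec k (.inl i)) (Y := indec k (.inl j))).subsingleton_congr]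
      constructor
      · rintro ⟨h0, h⟩
        by_contra! hij
        rcases Nat.eq_zero_or_pos (j.val - i.val) with h1 | h1
        · exact (subsingleton_ext_S_iff i j 0).1 h0 (by omega)
        · exact (subsingleton_ext_S_iff i j (j.val - i.val)).1 (h _ h1) (by omega)
      · intro h
        exact ⟨(subsingleton_ext_S_iff i j 0).2 (by omega),
          fun m _ => (subsingleton_ext_S_iff i j m).2 (by omega)⟩
    · change _ ↔ i.val ≠ b.val + 1
      have : Injective (M k b) := arrowMod_injective (tgt_injective n) b
      refine (and_iff_left fun m hm =>
        HasInjectiveDimensionLT.subsingleton (M k b) 1 m hm (S k i)).trans ?_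
      refine (subsingleton_hom_arrowMod_iff (tgt_injective n) b (S k i)).trans ?_
      rw [e_smul_simpleMod_eq_zero_iff, ne_comm, Ne, Fin.ext_iff]
  · have : Projective (M k a) := arrowMod_projective (src_injective n) a
    refine (and_iff_left fun m hm =>
      HasProjectiveDimensionLT.subsingleton (M k a) 1 m hm (indec k d)).trans ?_
    refine (subsingleton_arrowMod_hom_iff (src_injective n) a (indec k d)).trans ?_
    rcases d with j | b
    · change _ ↔ j.val ≠ a.val
      refine (e_smul_simpleMod_eq_zero_iff _ _).trans ?_
      rw [ne_comm, Ne, Fin.ext_iff]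
    · change _ ↔ a.val ≠ b.val ∧ a.val ≠ b.val + 1
      refine (e_smul_arrowMod_eq_zero_iff _ _).trans ?_
      rw [Ne, Ne, Fin.ext_iff, Fin.ext_iff]

theorem isExceptionalPair_iff {X Y : ModuleCat.{u} (LinearNakayama k n)}
    {d d' : Fin n ⊕ Fin (n - 1)} (e : X ≅ indec k d) (e' : Y ≅ indec k d') :
    IsExceptionalPair k X Y ↔ Admissible (code d) (code d') := by
  rw [← subsingleton_hom_indec_iff (k := k), ← subsingleton_hom_congr e' e]
  constructor
  · intro h
    exact ⟨h.hom, fun m hm => (subsingleton_ext_congr e' e m).1 (h.ext m hm)⟩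
  · rintro ⟨h0, h⟩
    exact ⟨(indec_isExceptional d).of_iso e.symm, (indec_isExceptional d').of_iso e'.symm, h0,
      fun m hm => (subsingleton_ext_congr e' e m).2 (h m hm)⟩

theorem indec_iso_unique {d d' : Fin n ⊕ Fin (n - 1)} (h : Nonempty (indec k d ≅ indec k d')) :
    d = d' := by
  obtain ⟨e⟩ := h
  have hl := (isSimpleModule_iff (Iso.refl (indec k d))).symm.trans (isSimpleModule_iff e)
  rcases d with i | a <;> rcases d' with j | b
  · by_contra hne
    have h1 : Subsingleton (S k i ⟶ S k j) :=
      (subsingleton_simpleMod_hom_iff i j).2 fun h => hne (by rw [h])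
    have h2 := (subsingleton_hom_congr (Iso.refl (S k i)) e.symm).1 h1
    exact (subsingleton_simpleMod_hom_iff i i).1 h2 rfl
  · simp at hl
  · simp at hl
  · by_contra hne
    have h1 : Subsingleton (M k a ⟶ S k (src n b)) :=
      (subsingleton_arrowMod_hom_iff (src_injective n) a _).2
        ((e_smul_simpleMod_eq_zero_iff _ _).2 fun h => hne (by rw [src_injective n h]))
    have h2 := (subsingleton_hom_congr e (Iso.refl (S k (src n b)))).1 h1
    exact (e_smul_simpleMod_eq_zero_iff (k := k) (s := src n) (t := tgt n) _ _).1
      ((subsingleton_arrowMod_hom_iff (src_injective n) b _).1 h2) rfl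

end LinearNakayama

/-! ### Combinatorics of admissible sequences -/

/-- A sequence of `n` codes of indecomposable modules in which all pairs are admissible. -/
structure IsAdmissibleSeq {n : ℕ} (e : Fin n → ℕ ⊕ ℕ) : Prop where
  vertex_lt : ∀ x i, e x = .inl i → i < n
  arrow_lt : ∀ x a, e x = .inr a → a + 1 < n
  admissible : ∀ x y, x < y → Admissible (e x) (e y)

/-- All arrows of the segment from `p` to `q` occur in `e`. -/
def Linked {n : ℕ} (e : Fin n → ℕ ⊕ ℕ) (p q : ℕ) : Prop :=
  ∀ b, p ≤ b → b < q → ∃ z, e z = .inr b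

/-- The term at position `y` is a vertex, the one at position `x` an arrow, and all arrows between
the two occur in `e`. -/
def IsLinkedTo {n : ℕ} (e : Fin n → ℕ ⊕ ℕ) (y x : Fin n) : Prop :=
  ∃ c a, e y = .inl c ∧ e x = .inr a ∧
    (c ≤ a ∧ Linked e c (a + 1) ∨ a < c ∧ Linked e a c)

/-- `f` fixes the positions of vertices and sends the position of an arrow to the position of a
vertex to which it is linked. -/
structure IsRootMap {n : ℕ} (e : Fin n → ℕ ⊕ ℕ) (f : Fin n → Fin n) : Prop where
  vertex : ∀ x c, e x = .inl c → f x = x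
  arrow : ∀ x a, e x = .inr a → IsLinkedTo e (f x) x

namespace IsAdmissibleSeq

variable {n : ℕ} {e : Fin n → ℕ ⊕ ℕ} (h : IsAdmissibleSeq e)

include h

theorem injective : Function.Injective e := by
  have key : ∀ x y, x < y → e x ≠ e y := by
    intro x y hxy hE
    have := h.admissible x y hxy
    rw [hE] at this
    rcases hy : e y with i | a <;> rw [hy] at this
    · exact lt_irrefl i this
    · exact this.1 rfl
  intro x y hE
  rcases lt_trichotomy x y with hxy | hxy | hxy
  · exact (key x y hxy hE).elim
  · exact hxy
  · exact (key y x hxy hE.symm).elim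

theorem lt_of_not_admissible {x y : Fin n} (hA : ¬ Admissible (e y) (e x)) (hne : e x ≠ e y) :
    x < y := by
  rcases lt_trichotomy x y with hxy | hxy | hxy
  · exact hxy
  · exact (hne (congrArg e hxy)).elim
  · exact (hA (h.admissible y x hxy)).elim

theorem vertex_lt_vertex {x y : Fin n} {i j : ℕ} (hx : e x = .inl i) (hy : e y = .inl j)
    (hij : i < j) : x < y :=
  h.lt_of_not_admissible (by rw [hx, hy]; exact hij.not_gt) (by rw [hx, hy]; simpa using hij.ne)

theorem arrow_lt_source {x y : Fin n} {a : ℕ} (hx : e x = .inr a) (hy : e y = .inl a) : x < y :=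
  h.lt_of_not_admissible (by rw [hx, hy]; exact fun h => h rfl) (by rw [hx, hy]; simp)

theorem target_lt_arrow {x y : Fin n} {a : ℕ} (hx : e x = .inr a) (hy : e y = .inl (a + 1)) :
    y < x :=
  h.lt_of_not_admissible (by rw [hx, hy]; exact fun h => h rfl) (by rw [hx, hy]; simp)

/-- Linked arrows occur in decreasing order. -/
theorem arrow_lt_arrow {x y : Fin n} {a b : ℕ} (hx : e x = .inr a) (hy : e y = .inr b)
    (hab : a < b) (hl : Linked e a b) : y < x := by
  induction b, hab using Nat.le_induction generalizing y with
  | base =>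
    exact h.lt_of_not_admissible (by rw [hx, hy]; exact fun h => h.2 rfl) (by rw [hx, hy]; simp)
  | succ b hab ih =>
    obtain ⟨z, hz⟩ := hl b (by omega) (by omega)
    have h1 := ih hz fun b' h1 h2 => hl b' h1 (by omega)
    have h2 : y < z :=
      h.lt_of_not_admissible (by rw [hz, hy]; exact fun h => h.2 rfl) (by rw [hz, hy]; simp)
    exact h2.trans h1

/-- An arrow precedes a vertex linked to it on its left. -/
theorem arrow_lt_vertex {x y : Fin n} {c a : ℕ} (hy : e y = .inl c) (hx : e x = .inr a)
    (hca : c ≤ a) (hl : Linked e c (a + 1)) : x < y := by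
  rcases hca.eq_or_lt with rfl | hlt
  · exact h.arrow_lt_source hx hy
  · obtain ⟨z, hz⟩ := hl c le_rfl (by omega)
    exact (h.arrow_lt_arrow hz hx hlt fun b h1 h2 => hl b h1 (by omega)).trans
      (h.arrow_lt_source hz hy)

/-- An arrow comes after a vertex linked to it on its right. -/
theorem vertex_lt_arrow {x y : Fin n} {c a : ℕ} (hy : e y = .inl c) (hx : e x = .inr a)
    (hac : a < c) (hl : Linked e a c) : y < x := by
  obtain ⟨c, rfl⟩ : ∃ d, c = d + 1 := ⟨c - 1, by omega⟩
  obtain ⟨z, hz⟩ := hl c (by omega) (by omega)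
  have h1 := h.target_lt_arrow hz hy
  rcases (show a ≤ c by omega).eq_or_lt with rfl | hlt
  · rwa [h.injective (hx.trans hz.symm)]
  · exact h1.trans (h.arrow_lt_arrow hx hz hlt fun b h2 h3 => hl b h2 (by omega))

/-- Two vertices of the sequence are not linked: if `c < d` were linked, the position of `d` would
precede that of the arrow `c`, which precedes that of `c`, which precedes that of `d`. -/
theorem not_linked {x y : Fin n} {c d : ℕ} (hx : e x = .inl c) (hy : e y = .inl d) (hcd : c < d)
    (hl : Linked e c d) : False := by
  obtain ⟨z, hz⟩ := hl c le_rfl hcd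
  have h1 := h.arrow_lt_source hz hx
  have h2 := h.vertex_lt_arrow hy hz hcd hl
  have h3 := h.vertex_lt_vertex hx hy hcd
  exact lt_irrefl _ (h1.trans (h3.trans h2))

/-- An arrow is linked to at most one vertex. -/
theorem linkedTo_unique {x y z : Fin n} (hy : IsLinkedTo e y x) (hz : IsLinkedTo e z x) :
    y = z := by
  obtain ⟨c, a, hc, ha, hca⟩ := hy
  obtain ⟨d, a', hd, ha', hda⟩ := hz
  obtain rfl : a = a' := by simpa [ha] using ha'
  have key : ∀ {y z : Fin n} {c d : ℕ}, e y = .inl c → e z = .inl d →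
      (c ≤ a ∧ Linked e c (a + 1) ∨ a < c ∧ Linked e a c) →
      (d ≤ a ∧ Linked e d (a + 1) ∨ a < d ∧ Linked e a d) → ¬ c < d := by
    intro y z c d hy hz h1 h2 hcd
    refine h.not_linked hy hz hcd fun b hb1 hb2 => ?_
    rcases h1 with ⟨h3, h4⟩ | ⟨h3, h4⟩ <;> rcases h2 with ⟨h5, h6⟩ | ⟨h5, h6⟩
    · exact h4 b hb1 (by omega)
    · rcases lt_or_ge b a with h7 | h7
      · exact h4 b hb1 (by omega)
      · exact h6 b h7 hb2
    · omega
    · exact h6 b (by omega) hb2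
  have h1 := key hc hd hca hda
  have h2 := key hd hc hda hca
  obtain rfl : c = d := by omega
  exact h.injective (hc.trans hd.symm)

omit h

/-- The arrow `a` is linked to a vertex of the sequence on its left. -/
def LeftRooted (e : Fin n → ℕ ⊕ ℕ) (a : ℕ) : Prop :=
  ∃ c y, c ≤ a ∧ e y = .inl c ∧ Linked e c (a + 1)

open Classical in
/-- The vertex attached to a position: the vertex itself, respectively the end of the arrow which is
farther from the vertex the arrow is linked to. -/
noncomputable def node (e : Fin n → ℕ ⊕ ℕ) (x : Fin n) : ℕ :=
  match e x with
  | .inl c => c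
  | .inr a => if LeftRooted e a then a + 1 else a

theorem node_vertex {x : Fin n} {c : ℕ} (hx : e x = .inl c) : node e x = c := by
  simp [node, hx]

theorem node_arrow_pos {x : Fin n} {a : ℕ} (hx : e x = .inr a) (ha : LeftRooted e a) :
    node e x = a + 1 := by
  simp [node, hx, ha]

theorem node_arrow_neg {x : Fin n} {a : ℕ} (hx : e x = .inr a) (ha : ¬ LeftRooted e a) :
    node e x = a := by
  simp [node, hx, ha]

include h

theorem node_lt (x : Fin n) : node e x < n := by
  rcases hx : e x with c | a
  · rw [node_vertex hx]; exact h.vertex_lt x c hx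
  · have := h.arrow_lt x a hx
    by_cases ha : LeftRooted e a
    · rwa [node_arrow_pos hx ha]
    · rw [node_arrow_neg hx ha]; omega

/-- Two positions with the same node would link two vertices, or extend a link from an arrow to the
next one and so make the latter `LeftRooted`. -/
theorem node_injective : Function.Injective (node e) := by
  have hva : ∀ {x y : Fin n} {c a : ℕ}, e x = .inl c → e y = .inr a → node e x ≠ node e y := by
    intro x y c a hx hy hE
    rw [node_vertex hx] at hE
    by_cases ha : LeftRooted e a
    · rw [node_arrow_pos hy ha] at hE
      obtain ⟨d, z, hd, hz, hl⟩ := ha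
      exact h.not_linked hz hx (by omega) (hE ▸ hl)
    · rw [node_arrow_neg hy ha] at hE
      subst hE
      exact ha ⟨c, x, le_rfl, hx, fun b h1 h2 => ⟨y, by rw [hy]; congr 1; omega⟩⟩
  have haa : ∀ {x y : Fin n} {a : ℕ}, e x = .inr a → LeftRooted e a → e y = .inr (a + 1) →
      LeftRooted e (a + 1) := by
    rintro x y a hx ⟨c, z, hca, hz, hl⟩ hy
    refine ⟨c, z, by omega, hz, fun b h1 h2 => ?_⟩
    rcases (show b ≤ a + 1 by omega).eq_or_lt with rfl | h3
    · exact ⟨y, hy⟩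
    · exact hl b h1 h3
  intro x y hE
  rcases hx : e x with c | a <;> rcases hy : e y with d | b
  · rw [node_vertex hx, node_vertex hy] at hE
    exact h.injective (by rw [hx, hy, hE])
  · exact (hva hx hy hE).elim
  · exact (hva hy hx hE.symm).elim
  · by_cases ha : LeftRooted e a <;> by_cases hb : LeftRooted e b
    · rw [node_arrow_pos hx ha, node_arrow_pos hy hb] at hE
      exact h.injective (by rw [hx, hy]; congr 1; omega)
    · rw [node_arrow_pos hx ha, node_arrow_neg hy hb] at hE
      subst hE
      exact (hb (haa hx ha hy)).elim
    · rw [node_arrow_neg hx ha, node_arrow_pos hy hb] at hE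
      subst hE
      exact (ha (haa hy hb hx)).elim
    · rw [node_arrow_neg hx ha, node_arrow_neg hy hb] at hE
      exact h.injective (by rw [hx, hy, hE])

theorem exists_node_eq {p : ℕ} (hp : p < n) : ∃ x, node e x = p := by
  have h1 : Function.Injective fun x => (⟨node e x, h.node_lt x⟩ : Fin n) := fun x y hxy =>
    h.node_injective (congrArg Fin.val hxy)
  obtain ⟨x, hx⟩ := (Finite.injective_iff_surjective.1 h1) ⟨p, hp⟩
  exact ⟨x, congrArg Fin.val hx⟩

/-- As the sequence is complete, every arrow is linked to a vertex: walking to the right from an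
arrow not linked to a vertex on its left, one meets a vertex, because every node is attached to some
position. -/
theorem exists_linkedTo {x : Fin n} {a : ℕ} (hx : e x = .inr a) : ∃ y, IsLinkedTo e y x := by
  by_cases ha : LeftRooted e a
  · obtain ⟨c, y, hca, hy, hl⟩ := ha
    exact ⟨y, c, a, hy, hx, .inl ⟨hca, hl⟩⟩
  suffices H : ∃ c y, a < c ∧ e y = .inl c ∧ Linked e a c by
    obtain ⟨c, y, hac, hy, hl⟩ := H
    exact ⟨y, c, a, hy, hx, .inr ⟨hac, hl⟩⟩
  obtain ⟨m, hm⟩ : ∃ m, n - a = m := ⟨_, rfl⟩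
  induction m using Nat.strong_induction_on generalizing a x with
  | _ m ih =>
    have han := h.arrow_lt x a hx
    have hone : Linked e a (a + 1) := fun b h1 h2 => ⟨x, by rw [hx]; congr 1; omega⟩
    obtain ⟨z, hz⟩ := h.exists_node_eq han
    rcases hez : e z with c | b
    · rw [node_vertex hez] at hz
      subst hz
      exact ⟨a + 1, z, by omega, hez, hone⟩
    · by_cases hb : LeftRooted e b
      · rw [node_arrow_pos hez hb] at hz
        obtain rfl : b = a := by omega
        exact (ha hb).elim
      · rw [node_arrow_neg hez hb] at hz
        subst hz
        obtain ⟨c, y, hc, hy, hl⟩ := ih (n - (a + 1)) (by omega) hez hb rfl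
        refine ⟨c, y, by omega, hy, fun b' h1 h2 => ?_⟩
        rcases h1.eq_or_lt with rfl | h3
        · exact ⟨x, hx⟩
        · exact hl b' h3 h2

theorem exists_isRootMap : ∃ f, IsRootMap e f := by
  have key : ∀ x, ∃ y, (∀ c, e x = .inl c → y = x) ∧ ∀ a, e x = .inr a → IsLinkedTo e y x := by
    intro x
    rcases hx : e x with c | a
    · exact ⟨x, by simp, by simp⟩
    · obtain ⟨y, hy⟩ := h.exists_linkedTo hx
      exact ⟨y, by simp, fun _ _ => hy⟩
  choose f hf using key
  exact ⟨f, fun x => (hf x).1, fun x => (hf x).2⟩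

theorem isRootMap_unique {f g : Fin n → Fin n} (hf : IsRootMap e f) (hg : IsRootMap e g) :
    f = g := by
  funext x
  rcases hx : e x with c | a
  · rw [hf.vertex x c hx, hg.vertex x c hx]
  · exact h.linkedTo_unique (hf.arrow x a hx) (hg.arrow x a hx)

omit h in
theorem _root_.IsRootMap.idempotent {f : Fin n → Fin n} (hf : IsRootMap e f) (x : Fin n) :
    f (f x) = f x := by
  rcases hx : e x with c | a
  · rw [hf.vertex x c hx, hf.vertex x c hx]
  · obtain ⟨c, -, hc, -⟩ := hf.arrow x a hx
    exact hf.vertex _ c hc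

/-- With respect to the root `c` of `x`, the position `x` is that of `c` itself, or of an arrow on
the right of `c`, attached to its target, or of an arrow on the left of `c`, attached to its source.
-/
theorem node_spec {f : Fin n → Fin n} (hf : IsRootMap e f) (x : Fin n) :
    ∃ c, e (f x) = .inl c ∧
      (e x = .inl c ∧ node e x = c ∨
        (∃ a, e x = .inr a ∧ c ≤ a ∧ Linked e c (a + 1) ∧ node e x = a + 1) ∨
        ∃ a, e x = .inr a ∧ a < c ∧ Linked e a c ∧ node e x = a) := by
  rcases hx : e x with c | a
  · exact ⟨c, by rw [hf.vertex x c hx, hx], .inl ⟨rfl, node_vertex hx⟩⟩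
  · obtain ⟨c, a', hc, ha', hl⟩ := hf.arrow x a hx
    obtain rfl : a = a' := by simpa [hx] using ha'
    refine ⟨c, hc, .inr (hl.imp ?_ ?_)⟩
    · rintro ⟨h1, h2⟩
      exact ⟨a, rfl, h1, h2, node_arrow_pos hx ⟨c, f x, h1, hc, h2⟩⟩
    · rintro ⟨h1, h2⟩
      refine ⟨a, rfl, h1, h2, node_arrow_neg hx ?_⟩
      rintro ⟨d, y, hd, hy, hl'⟩
      refine h.not_linked hy hc (by omega) fun b hb1 hb2 => ?_
      rcases lt_or_ge b a with h3 | h3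
      · exact hl' b hb1 (by omega)
      · exact h2 b h3 hb2

end IsAdmissibleSeq

/-! ### Reconstruction of a sequence from its root map -/

/-- The order in which the positions are attached to the nodes of the quiver: first by root, then by
decreasing position. -/
def NodeLT {n : ℕ} (f : Fin n → Fin n) (z x : Fin n) : Prop :=
  f z < f x ∨ f z = f x ∧ x < z

theorem NodeLT.trichotomy {n : ℕ} (f : Fin n → Fin n) (z x : Fin n) :
    NodeLT f z x ∨ z = x ∨ NodeLT f x z := by
  simp only [NodeLT, Fin.lt_def, Fin.ext_iff]; omega

theorem NodeLT.trans {n : ℕ} {f : Fin n → Fin n} {x y z : Fin n} (h₁ : NodeLT f x y)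
    (h₂ : NodeLT f y z) : NodeLT f x z := by
  simp only [NodeLT, Fin.lt_def, Fin.ext_iff] at *; omega

theorem NodeLT.irrefl {n : ℕ} (f : Fin n → Fin n) (x : Fin n) : ¬ NodeLT f x x := by
  simp [NodeLT]

/-- `ν` numbers the positions `0, …, n - 1` increasingly with respect to `NodeLT f`. -/
structure IsNumbering {n : ℕ} (f : Fin n → Fin n) (ν : Fin n → ℕ) : Prop where
  lt : ∀ x, ν x < n
  mono : ∀ z x, NodeLT f z x → ν z < ν x

namespace IsNumbering

variable {n : ℕ} {f : Fin n → Fin n} {ν : Fin n → ℕ}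

theorem lt_iff (h : IsNumbering f ν) (z x : Fin n) : ν z < ν x ↔ NodeLT f z x := by
  refine ⟨fun h1 => ?_, h.mono z x⟩
  rcases NodeLT.trichotomy f z x with h2 | rfl | h2
  · exact h2
  · exact (lt_irrefl _ h1).elim
  · exact (lt_asymm h1 (h.mono x z h2)).elim

theorem injective (h : IsNumbering f ν) : Function.Injective ν := by
  intro z x hE
  rcases NodeLT.trichotomy f z x with h2 | h2 | h2
  · exact ((h.mono z x h2).ne hE).elim
  · exact h2
  · exact ((h.mono x z h2).ne' hE).elim

theorem exists_eq (h : IsNumbering f ν) {p : ℕ} (hp : p < n) : ∃ x, ν x = p := by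
  have h1 : Function.Injective fun x => (⟨ν x, h.lt x⟩ : Fin n) := fun x y hxy =>
    h.injective (congrArg Fin.val hxy)
  obtain ⟨x, hx⟩ := (Finite.injective_iff_surjective.1 h1) ⟨p, hp⟩
  exact ⟨x, congrArg Fin.val hx⟩

/-- The number of `x` is the number of positions below `x`. -/
theorem unique {μ : Fin n → ℕ} (h : IsNumbering f ν) (h' : IsNumbering f μ) : ν = μ := by
  classical
  have key : ∀ {ν : Fin n → ℕ}, IsNumbering f ν → ∀ x,
      ν x = (Finset.univ.filter fun z => NodeLT f z x).card := by
    intro ν h x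
    rw [← Finset.card_image_of_injective _ h.injective, ← Finset.card_range (ν x)]
    congr 1
    ext p
    simp only [Finset.mem_range, Finset.mem_image, Finset.mem_filter, Finset.mem_univ, true_and]
    constructor
    · intro hp
      obtain ⟨z, rfl⟩ := h.exists_eq (hp.trans (h.lt x))
      exact ⟨z, (h.lt_iff z x).1 hp, rfl⟩
    · rintro ⟨z, hz, rfl⟩
      exact h.mono z x hz
  funext x
  rw [key h, key h']

theorem exists_isNumbering (f : Fin n → Fin n) : ∃ ν, IsNumbering f ν := by
  classical
  refine ⟨fun x => (Finset.univ.filter fun z => NodeLT f z x).card, fun x => ?_, fun z x hzx => ?_⟩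
  · refine (Finset.card_lt_card (t := Finset.univ) ?_).trans_eq (Finset.card_fin n)
    rw [Finset.ssubset_univ_iff]
    intro hE
    have := Finset.mem_univ x
    rw [← hE, Finset.mem_filter] at this
    exact NodeLT.irrefl f x this.2
  · refine Finset.card_lt_card (Finset.ssubset_iff_of_subset ?_ |>.2 ⟨z, ?_, ?_⟩)
    · intro w hw
      simp only [Finset.mem_filter, Finset.mem_univ, true_and] at hw ⊢
      exact hw.trans hzx
    · simpa using hzx
    · simpa using NodeLT.irrefl f z

end IsNumbering

/-- The sequence of codes determined by an idempotent map `f` and a numbering `ν` of the positions.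
A fixed point of `f` becomes a vertex, and any other position becomes the arrow joining its node to
the neighbouring node closer to the root. -/
def decode {n : ℕ} (f : Fin n → Fin n) (ν : Fin n → ℕ) (x : Fin n) : ℕ ⊕ ℕ :=
  if f x = x then .inl (ν x) else if f x < x then .inr (ν x) else .inr (ν x - 1)

namespace IsAdmissibleSeq

variable {n : ℕ} {e : Fin n → ℕ ⊕ ℕ} (h : IsAdmissibleSeq e) {f : Fin n → Fin n}
  (hf : IsRootMap e f)

include h hf

/-- The intervals follow one another in the order of the positions of their roots, and inside an
interval the positions decrease when the nodes increase. -/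
theorem isNumbering_node : IsNumbering f (node e) where
  lt := h.node_lt
  mono z x hzx := by
    obtain ⟨c, hc, hz⟩ := h.node_spec hf z
    obtain ⟨d, hd, hx⟩ := h.node_spec hf x
    rcases hzx with hlt | ⟨hE, hlt⟩
    · have hcd : c < d := by
        by_contra! hdc
        rcases hdc.eq_or_lt with rfl | hdc
        · exact hlt.ne (h.injective (hc.trans hd.symm))
        · exact hlt.not_gt (h.vertex_lt_vertex hd hc hdc)
      -- Otherwise the segments from `c` to the node of `z` and from `d` to the node of `x` overlap
      -- and link the two roots.
      by_contra! hle
      refine h.not_linked hc hd hcd fun b hb1 hb2 => ?_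
      rcases lt_or_ge b (node e z) with hb | hb
      · rcases hz with ⟨-, h2⟩ | ⟨a, -, h1, hl, h2⟩ | ⟨a, -, h1, hl, h2⟩
        · omega
        · exact hl b hb1 (by omega)
        · omega
      · rcases hx with ⟨-, h2⟩ | ⟨a, -, h1, hl, h2⟩ | ⟨a, -, h1, hl, h2⟩
        · omega
        · omega
        · exact hl b (by omega) hb2
    · rw [← hE, hc] at hd
      obtain rfl : c = d := by simpa using hd
      by_contra! hle
      have hne : node e x ≠ node e z := fun h' => hlt.ne (h.node_injective h')
      refine hlt.not_gt ?_
      rcases hx with ⟨hx, h2⟩ | ⟨a, hx, h1, hl, h2⟩ | ⟨a, hx, h1, hl, h2⟩ <;>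
      rcases hz with ⟨hz, h2'⟩ | ⟨b, hz, h1', hl', h2'⟩ | ⟨b, hz, h1', hl', h2'⟩
      · omega
      · exact h.arrow_lt_vertex hx hz h1' hl'
      · omega
      · omega
      · exact h.arrow_lt_arrow hx hz (by omega) fun b' hb1 hb2 => hl' b' (by omega) (by omega)
      · omega
      · exact h.vertex_lt_arrow hz hx h1 hl
      · exact (h.arrow_lt_vertex hc hz h1' hl').trans (h.vertex_lt_arrow hc hx h1 hl)
      · exact h.arrow_lt_arrow hx hz (by omega) fun b' hb1 hb2 => hl b' (by omega) (by omega)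

theorem eq_decode : e = decode f (node e) := by
  funext x
  obtain ⟨c, hc, hx | ⟨a, hx, h1, hl, h2⟩ | ⟨a, hx, h1, hl, h2⟩⟩ := h.node_spec hf x
  · rw [decode, if_pos (hf.vertex x c hx.1), hx.1, hx.2]
  · have h3 := h.arrow_lt_vertex hc hx h1 hl
    rw [decode, if_neg h3.ne', if_neg h3.not_gt, h2, hx, Nat.add_sub_cancel]
  · have h3 := h.vertex_lt_arrow hc hx h1 hl
    rw [decode, if_neg h3.ne, if_pos h3, h2, hx]

/-- An admissible sequence is determined by its root map. -/
theorem eq_of_isRootMap {e' : Fin n → ℕ ⊕ ℕ} (h' : IsAdmissibleSeq e') (hf' : IsRootMap e' f) :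
    e = e' := by
  rw [h.eq_decode hf, h'.eq_decode hf',
    (h.isNumbering_node hf).unique (h'.isNumbering_node hf')]

end IsAdmissibleSeq

section Decode

variable {n : ℕ} {f : Fin n → Fin n} {ν : Fin n → ℕ}

theorem decode_vertex {x : Fin n} (hx : f x = x) : decode f ν x = .inl (ν x) := by
  rw [decode, if_pos hx]

theorem decode_left {x : Fin n} (hx : f x < x) : decode f ν x = .inr (ν x) := by
  rw [decode, if_neg hx.ne, if_pos hx]

theorem decode_right {x : Fin n} (hx : x < f x) : decode f ν x = .inr (ν x - 1) := by
  rw [decode, if_neg hx.ne', if_neg hx.not_gt]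

variable (hf : ∀ x, f (f x) = f x) (h : IsNumbering f ν)

include hf h

/-- Terms to the right of their root correspond to nodes to the left of it, and conversely. -/
theorem IsNumbering.lt_root {x : Fin n} (hx : f x < x) : ν x < ν (f x) :=
  h.mono _ _ (.inr ⟨(hf x).symm, hx⟩)

theorem IsNumbering.root_lt {x : Fin n} (hx : x < f x) : ν (f x) < ν x :=
  h.mono _ _ (.inr ⟨hf x, hx⟩)

theorem IsNumbering.lt_root_of_lt {x y : Fin n} (hxy : f x < f y) : ν x < ν (f y) :=
  h.mono _ _ (.inl (by rwa [hf]))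

theorem IsNumbering.root_lt_of_lt {x y : Fin n} (hxy : f x < f y) : ν (f x) < ν y :=
  h.mono _ _ (.inl (by rwa [hf]))

/-- Two terms violating admissibility would have equal or adjacent nodes; but the nodes of terms
with different roots are separated by the roots, and those of terms with the same root are in the
right order. -/
theorem isAdmissibleSeq_decode : IsAdmissibleSeq (decode f ν) where
  vertex_lt x i hx := by
    rcases lt_trichotomy (f x) x with h1 | h1 | h1
    · simp [decode_left h1] at hx
    · rw [decode_vertex h1] at hx
      have := h.lt x
      simp only [Sum.inl.injEq] at hx
      omega
    · simp [decode_right h1] at hx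
  arrow_lt x a hx := by
    have h2 := h.lt x
    have h3 := h.lt (f x)
    rcases lt_trichotomy (f x) x with h1 | h1 | h1
    · rw [decode_left h1] at hx
      have := h.lt_root hf h1
      simp only [Sum.inr.injEq] at hx
      omega
    · simp [decode_vertex h1] at hx
    · rw [decode_right h1] at hx
      have := h.root_lt hf h1
      simp only [Sum.inr.injEq] at hx
      omega
  admissible x y hxy := by
    have hne : ν x ≠ ν y := fun hE => hxy.ne (h.injective hE)
    rcases lt_trichotomy (f x) x with hx | hx | hx <;>
    rcases lt_trichotomy (f y) y with hy | hy | hy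
    · rw [decode_left hx, decode_left hy]
      refine ⟨hne.symm, fun hE => ?_⟩
      have h1 := h.lt_root hf hx
      have h2 := (h.lt_iff x y).1 (by omega)
      rcases h2 with h2 | h2
      · have := h.root_lt_of_lt hf h2; omega
      · exact hxy.not_gt h2.2
    · rw [decode_left hx, decode_vertex hy]
      intro hE
      have h1 := h.lt_root hf hx
      have := h.root_lt_of_lt hf (x := x) (y := y) (by rw [hy]; exact hx.trans hxy)
      omega
    · rw [decode_left hx, decode_right hy]
      have h1 := h.lt_root hf hx
      have h2 := h.root_lt hf hy
      have h3 := h.root_lt_of_lt hf (x := x) (y := f y)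
        (by rw [hf]; exact (hx.trans hxy).trans hy)
      constructor <;> omega
    · rw [decode_vertex hx, decode_left hy]
      exact hne
    · rw [decode_vertex hx, decode_vertex hy]
      exact h.mono _ _ (.inl (by rwa [hx, hy]))
    · rw [decode_vertex hx, decode_right hy]
      intro hE
      have h2 := h.root_lt hf hy
      have h3 := h.lt_root_of_lt hf (x := x) (y := y) (by rw [hx]; exact hxy.trans hy)
      omega
    · rw [decode_right hx, decode_left hy]
      have h1 := h.root_lt hf hx
      have h2 := h.lt_root hf hy
      refine ⟨fun hE => ?_, by omega⟩
      rcases (h.lt_iff y x).1 (by omega) with h3 | h3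
      · have := h.root_lt_of_lt hf h3
        have := h.lt_root_of_lt hf h3
        omega
      · rw [h3.1] at h2; omega
    · rw [decode_right hx, decode_vertex hy]
      have h1 := h.root_lt hf hx
      intro hE
      omega
    · rw [decode_right hx, decode_right hy]
      have h1 := h.root_lt hf hx
      have h2 := h.root_lt hf hy
      refine ⟨by omega, fun hE => ?_⟩
      rcases (h.lt_iff x y).1 (by omega) with h3 | h3
      · have := h.lt_root_of_lt hf h3; omega
      · exact hxy.not_gt h3.2

/-- The nodes between the node of a term and that of its root belong to terms with the same root, on
the same side of it, and so are attached to the arrows needed for a link. -/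
theorem isRootMap_decode : IsRootMap (decode f ν) f where
  vertex x c hx := by
    rcases lt_trichotomy (f x) x with h1 | h1 | h1
    · simp [decode_left h1] at hx
    · exact h1
    · simp [decode_right h1] at hx
  arrow x a hx := by
    rcases lt_trichotomy (f x) x with h1 | h1 | h1
    · have h2 := h.lt_root hf h1
      refine ⟨ν (f x), ν x, decode_vertex (hf x), decode_left h1, .inr ⟨h2, fun b hb1 hb2 => ?_⟩⟩
      obtain ⟨z, rfl⟩ := h.exists_eq (hb2.trans (h.lt _))
      have h3 := (h.lt_iff z (f x)).1 hb2
      have h4 := (h.lt_iff z x).not.1 (by omega)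
      refine ⟨z, decode_left ?_⟩
      simp only [NodeLT, hf, Fin.lt_def, Fin.ext_iff] at h3 h4 h1 ⊢
      omega
    · simp [decode_vertex h1] at hx
    · have h2 := h.root_lt hf h1
      refine ⟨ν (f x), ν x - 1, decode_vertex (hf x), decode_right h1,
        .inl ⟨by omega, fun b hb1 hb2 => ?_⟩⟩
      have h5 := h.lt x
      obtain ⟨z, hz⟩ := h.exists_eq (show b + 1 < n by omega)
      have h3 := (h.lt_iff (f x) z).1 (by omega)
      have h4 := (h.lt_iff x z).not.1 (by omega)
      refine ⟨z, ?_⟩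
      rw [decode_right, hz, Nat.add_sub_cancel]
      simp only [NodeLT, hf, Fin.lt_def, Fin.ext_iff] at h3 h4 h1 ⊢
      omega

end Decode

/-! ### Complete exceptional sequences and their root maps -/

namespace LinearNakayama

variable {k : Type u} [Field k] {n : ℕ}

/-- `d` lists the indices of the indecomposable modules in the sequence `E`. -/
def IsIndexing (E : Fin n → ModIsoClass (LinearNakayama k n)) (d : Fin n → Fin n ⊕ Fin (n - 1)) :
    Prop :=
  ∀ x, Nonempty ((E x).rep ≅ indec k (d x))

theorem exists_isIndexing {E : Fin n → ModIsoClass (LinearNakayama k n)}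
    (hE : IsExceptionalSequence k E) : ∃ d, IsIndexing E d := by
  choose d hd using fun x => exists_iso_indec (hE.exceptional x)
  exact ⟨d, hd⟩

namespace IsIndexing

variable {E : Fin n → ModIsoClass (LinearNakayama k n)} {d : Fin n → Fin n ⊕ Fin (n - 1)}
  (hd : IsIndexing E d)

include hd

theorem eq {E' : Fin n → ModIsoClass (LinearNakayama k n)} (hd' : IsIndexing E' d) : E = E' := by
  funext x
  obtain ⟨i⟩ := hd x
  obtain ⟨j⟩ := hd' x
  rw [← Quotient.out_eq (E x), ← Quotient.out_eq (E' x)]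
  exact Quotient.sound ⟨i ≪≫ j.symm⟩

theorem unique {d' : Fin n → Fin n ⊕ Fin (n - 1)} (hd' : IsIndexing E d') : d = d' := by
  funext x
  obtain ⟨i⟩ := hd x
  obtain ⟨j⟩ := hd' x
  exact indec_iso_unique ⟨i.symm ≪≫ j⟩

theorem nonempty_iso_iff (x : Fin n) (d' : Fin n ⊕ Fin (n - 1)) :
    Nonempty ((E x).rep ≅ indec k d') ↔ d x = d' := by
  obtain ⟨i⟩ := hd x
  refine ⟨fun ⟨j⟩ => indec_iso_unique ⟨i.symm ≪≫ j⟩, ?_⟩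
  rintro rfl
  exact ⟨i⟩

theorem isExceptionalSequence_iff :
    IsExceptionalSequence k E ↔ IsAdmissibleSeq fun x => code (d x) := by
  constructor
  · intro hE
    refine ⟨fun x i hx => ?_, fun x a hx => ?_, fun x y hxy => ?_⟩
    · rcases h : d x with j | b <;> simp only [h, Sum.map_inl, Sum.map_inr] at hx
      · simp only [Sum.inl.injEq] at hx; omega
      · simp at hx
    · rcases h : d x with j | b <;> simp only [h, Sum.map_inl, Sum.map_inr] at hx
      · simp at hx
      · simp only [Sum.inr.injEq] at hx; omega
    · obtain ⟨i⟩ := hd x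
      obtain ⟨j⟩ := hd y
      exact (isExceptionalPair_iff i j).1 (hE.pair x y hxy)
  · intro h
    refine ⟨fun x => ?_, fun x y hxy => ?_⟩
    · obtain ⟨i⟩ := hd x
      exact (indec_isExceptional (d x)).of_iso i.symm
    · obtain ⟨i⟩ := hd x
      obtain ⟨j⟩ := hd y
      exact (isExceptionalPair_iff i j).2 (h.admissible x y hxy)

theorem simpleAt_iff (x : Fin n) : SimpleAt E x ↔ ∃ c, d x = .inl c := by
  obtain ⟨i⟩ := hd x
  exact (isSimpleModule_iff i).trans Sum.isLeft_iff

theorem isProjCoverOfSyzygy_iff {y : Fin n} {c : Fin n} (hy : d y = .inl c) {r : ℕ}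
    (hr : c.val + r + 1 < n) (x : Fin n) :
    IsProjCoverOfSyzygy (E y).rep r (E x).rep ↔ code (d x) = .inr (c.val + r) := by
  obtain ⟨i⟩ := (hd.nonempty_iso_iff y _).2 hy
  rw [LinearNakayama.isProjCoverOfSyzygy_iff i r (by omega)]
  refine (hd.nonempty_iso_iff x (.inr ⟨c.val + r, by omega⟩)).trans ?_
  rw [← code_injective.eq_iff]
  rfl

theorem isInjEnvelopeOfCosyzygy_iff {y : Fin n} {c : Fin n} (hy : d y = .inl c) {r : ℕ}
    (hr : r < c.val) (x : Fin n) :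
    IsInjEnvelopeOfCosyzygy (E y).rep r (E x).rep ↔ code (d x) = .inr (c.val - (r + 1)) := by
  obtain ⟨i⟩ := (hd.nonempty_iso_iff y _).2 hy
  rw [LinearNakayama.isInjEnvelopeOfCosyzygy_iff i r hr]
  refine (hd.nonempty_iso_iff x (.inr ⟨c.val - (r + 1), by omega⟩)).trans ?_
  rw [← code_injective.eq_iff]
  rfl

theorem containsProjChain_iff {y : Fin n} {c : Fin n} (hy : d y = .inl c) (x : Fin n) :
    ContainsProjChain E y x ↔ ∃ a, code (d x) = .inr a ∧ c.val ≤ a ∧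
      Linked (fun x => code (d x)) c (a + 1) := by
  obtain ⟨i⟩ := (hd.nonempty_iso_iff y _).2 hy
  have hpd : ∀ t : ℕ, (t : WithBot ℕ∞) < projectiveDimension (E y).rep ↔ c.val + t + 1 < n :=
    fun t => by rw [projectiveDimension_eq_of_iso i]; exact lt_projectiveDimension_S_iff c t
  constructor
  · rintro ⟨t, ht, hx, hr⟩
    rw [hpd] at ht
    refine ⟨c + t, (hd.isProjCoverOfSyzygy_iff hy ht x).1 hx, by omega, fun b hb1 hb2 => ?_⟩
    obtain ⟨z, hz⟩ := hr (b - c) (by omega)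
    refine ⟨z, ((hd.isProjCoverOfSyzygy_iff hy (by omega) z).1 hz).trans ?_⟩
    congr 1; omega
  · rintro ⟨a, hx, hca, hl⟩
    have ha : a + 1 < n := by
      rcases h : d x with j | b <;> simp only [h, Sum.map_inl, Sum.map_inr] at hx
      · simp at hx
      · simp only [Sum.inr.injEq] at hx; omega
    refine ⟨a - c, (hpd _).2 (by omega), (hd.isProjCoverOfSyzygy_iff hy (by omega) x).2 ?_,
      fun r hr => ?_⟩
    · rw [hx]; congr 1; omega
    · obtain ⟨z, hz⟩ := hl (c + r) (by omega) (by omega)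
      exact ⟨z, (hd.isProjCoverOfSyzygy_iff hy (by omega) z).2 hz⟩

theorem containsInjChain_iff {y : Fin n} {c : Fin n} (hy : d y = .inl c) (x : Fin n) :
    ContainsInjChain E y x ↔ ∃ a, code (d x) = .inr a ∧ a < c.val ∧
      Linked (fun x => code (d x)) a c := by
  obtain ⟨i⟩ := (hd.nonempty_iso_iff y _).2 hy
  have hid : ∀ t : ℕ, (t : WithBot ℕ∞) < injectiveDimension (E y).rep ↔ t < c.val :=
    fun t => by rw [injectiveDimension_eq_of_iso i]; exact lt_injectiveDimension_S_iff c t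
  constructor
  · rintro ⟨t, ht, hx, hr⟩
    rw [hid] at ht
    refine ⟨c - (t + 1), (hd.isInjEnvelopeOfCosyzygy_iff hy ht x).1 hx, by omega,
      fun b hb1 hb2 => ?_⟩
    obtain ⟨z, hz⟩ := hr (c - (b + 1)) (by omega)
    refine ⟨z, ((hd.isInjEnvelopeOfCosyzygy_iff hy (by omega) z).1 hz).trans ?_⟩
    congr 1; omega
  · rintro ⟨a, hx, hca, hl⟩
    refine ⟨c - (a + 1), (hid _).2 (by omega),
      (hd.isInjEnvelopeOfCosyzygy_iff hy (by omega) x).2 ?_, fun r hr => ?_⟩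
    · rw [hx]; congr 1; omega
    · obtain ⟨z, hz⟩ := hl (c - (r + 1)) (by omega) (by omega)
      exact ⟨z, (hd.isInjEnvelopeOfCosyzygy_iff hy (by omega) z).2 hz⟩

/-- Chains of resolutions are links: the terms of a projective chain starting at `S c` are the
modules `M c, M (c + 1), …`, those of an injective chain are `M (c - 1), M (c - 2), …`. -/
theorem isLinkedTo_iff (y x : Fin n) :
    IsLinkedTo (fun x => code (d x)) y x ↔
      SimpleAt E y ∧ (ContainsProjChain E y x ∨ ContainsInjChain E y x) := by
  rw [hd.simpleAt_iff]
  constructor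
  · rintro ⟨c, a, hy, hx, hl⟩
    rcases h : d y with j | b
    · obtain rfl : j.val = c := by simpa [h] using hy
      refine ⟨⟨j, rfl⟩, ?_⟩
      rw [hd.containsProjChain_iff h, hd.containsInjChain_iff h]
      exact hl.imp (fun hl => ⟨a, hx, hl⟩) fun hl => ⟨a, hx, hl⟩
    · simp [h] at hy
  · rintro ⟨⟨c, hc⟩, hl⟩
    rw [hd.containsProjChain_iff hc, hd.containsInjChain_iff hc] at hl
    rcases hl with ⟨a, hx, hl⟩ | ⟨a, hx, hl⟩
    · exact ⟨c, a, by simp [hc], hx, .inl hl⟩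
    · exact ⟨c, a, by simp [hc], hx, .inr hl⟩

end IsIndexing

theorem exists_code_eq {e : Fin n → ℕ ⊕ ℕ} (h : IsAdmissibleSeq e) :
    ∃ d : Fin n → Fin n ⊕ Fin (n - 1), (fun x => code (d x)) = e := by
  have key : ∀ x, ∃ d : Fin n ⊕ Fin (n - 1), code d = e x := by
    intro x
    rcases hx : e x with i | a
    · exact ⟨.inl ⟨i, h.vertex_lt x i hx⟩, rfl⟩
    · have := h.arrow_lt x a hx
      exact ⟨.inr ⟨a, by omega⟩, rfl⟩
  choose d hd using key
  exact ⟨d, funext hd⟩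

end LinearNakayama

theorem mainTheorem1 (k : Type u) [Field k] [IsAlgClosed k] (n : ℕ) :
    ∃ Φ : CompleteExceptionalSequence k n → {f : Fin n → Fin n // ∀ x, f (f x) = f x},
      (∀ (E : CompleteExceptionalSequence k n) (x : Fin n),
        SimpleAt E.1 x → (Φ E).1 x = x) ∧
      (∀ (E : CompleteExceptionalSequence k n) (x : Fin n), ¬ SimpleAt E.1 x →
        ∀ y : Fin n, (Φ E).1 x = y ↔
          SimpleAt E.1 y ∧ (ContainsProjChain E.1 y x ∨ ContainsInjChain E.1 y x)) ∧
      Function.Bijective Φ := by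
  choose d hd using fun E : CompleteExceptionalSequence k n => LinearNakayama.exists_isIndexing E.2
  have hadm := fun E => (hd E).isExceptionalSequence_iff.1 E.2
  choose f hf using fun E => (hadm E).exists_isRootMap
  refine ⟨fun E => ⟨f E, (hf E).idempotent⟩, fun E x hx => ?_, fun E x hx y => ?_, fun E E' h => ?_,
    fun g => ?_⟩
  · obtain ⟨c, hc⟩ := ((hd E).simpleAt_iff x).1 hx
    exact (hf E).vertex x c (by simp [hc])
  · rw [← (hd E).isLinkedTo_iff]
    have hroot : IsLinkedTo (fun x => LinearNakayama.code (d E x)) (f E x) x := by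
      rcases h : d E x with c | a
      · exact (hx (((hd E).simpleAt_iff x).2 ⟨c, h⟩)).elim
      · exact (hf E).arrow x a (by simp [h])
    refine ⟨?_, fun hy => (hadm E).linkedTo_unique hroot hy⟩
    rintro rfl
    exact hroot
  · have hff : f E = f E' := congrArg Subtype.val h
    have hcode := (hadm E).eq_of_isRootMap (hf E) (hadm E') (hff ▸ hf E')
    have hdd : d E = d E' := funext fun x =>
      LinearNakayama.code_injective (congrFun hcode x)
    exact Subtype.ext ((hd E).eq (hdd ▸ hd E'))
  · obtain ⟨ν, hν⟩ := IsNumbering.exists_isNumbering g.1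
    have hA := isAdmissibleSeq_decode g.2 hν
    obtain ⟨d₀, hd₀⟩ := LinearNakayama.exists_code_eq hA
    have hidx : LinearNakayama.IsIndexing (fun x =>
        (⟦LinearNakayama.indec k (d₀ x)⟧ : ModIsoClass (LinearNakayama k n))) d₀ :=
      fun x => Quotient.mk_out (s := isIsomorphicSetoid _) (LinearNakayama.indec k (d₀ x))
    let E : CompleteExceptionalSequence k n :=
      ⟨_, hidx.isExceptionalSequence_iff.2 (by rw [hd₀]; exact hA)⟩
    refine ⟨E, Subtype.ext ?_⟩
    have hE : d E = d₀ := (hd E).unique hidx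
    refine (hadm E).isRootMap_unique (hf E) ?_
    rw [hE, hd₀]
    exact isRootMap_decode g.2 hν
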